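/- Let $n=3$ and $p=-1$. For $q\in\{2,3,4\}$ put $$K(x)=\frac{\|x\|^{q}}{q}+\frac1{\|x\|},\qquad E(u)=\int_{\mathbb R^3\times\mathbb R^3}K(x-y)\,u(x)u(y)\,dx\,dy ,$$ and, for $m,M>0$, let $\mathcal A$ be the set of integrable functions $u$ on $\mathbb R^3$ with $\int(\|x\|^q+1)|u(x)|\,dx<\infty$, $u\ge0$ a.e., $\|u\|_\infty\le M$ and $\int_{\mathbb R^3}u\,dx=m$. A minimizer is an element $u\in\mathcal A$ with $E(u)\le E(v)$ for all $v\in\mathcal A$. Let $M,a>0$, let $m=\frac{4\pi}{3}Ma^3$, and let $u_a=M\mathbf 1_{\{\|x\|\le a\}}$. Then $u_a\in\mathcal A$ for each $q\in\{2,3,4\}$, and the following hold. 1. For $q=2$: $u_a$ is a minimizer if and only if $a\ge1$, equivalently $\dfrac mM\ge\dfrac{4\pi}{3}$. 2. For $q=3$: $u_a$ is a minimizer if and only if $a^4\ge\dfrac{21}{25}$, equivalently $\dfrac mM\ge\dfrac{4\pi}{3}\left(\dfrac{21}{25}\right)^{3/4}$. 3. For $q=4$: $u_a$ is a minimizer if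 and only if $a^5\ge\dfrac23$, equivalently $\dfrac mM\ge\dfrac{4\pi}{3}\left(\dfrac23\right)^{3/5}$. In each case, whenever $u_a$ is a minimizer it is the only one up to translation: every minimizer agrees almost everywhere with $x\mapsto u_a(x-c)$ for some $c\in\mathbb R^3$. -/

import Mathlib

open MeasureTheory Real

noncomputable section

/-- The attractive-repulsive power-law kernel `K(x) = ‖x‖ ^ q / q - ‖x‖ ^ p / p` on `ℝⁿ`. -/
def powerKernel (n : ℕ) (p q : ℝ) (x : EuclideanSpace ℝ (Fin n)) : ℝ :=
  ‖x‖ ^ q / q - ‖x‖ ^ p / p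

/-- The interaction energy `E(u) = ∫∫ K(x - y) u(x) u(y) dx dy`, for `p < 0 < q` and `u ≥ 0`.
Then the integrand is nonnegative, and the integral is taken with values in `[0, ∞]`. -/
def interactionEnergy (n : ℕ) (p q : ℝ) (u : EuclideanSpace ℝ (Fin n) → ℝ) : ENNReal :=
  ∫⁻ z : EuclideanSpace ℝ (Fin n) × EuclideanSpace ℝ (Fin n),
    ENNReal.ofReal (powerKernel n p q (z.1 - z.2) * u z.1 * u z.2)

/-- The admissible densities: integrable functions on `ℝⁿ` with finite `q`-th moment,
`u ≥ 0` almost everywhere, `‖u‖_∞ ≤ M` and total mass `m`. -/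
structure IsAdmissible (n : ℕ) (q m M : ℝ) (u : EuclideanSpace ℝ (Fin n) → ℝ) : Prop where
  integrable : Integrable u
  moment : Integrable fun x => (‖x‖ ^ q + 1) * |u x|
  nonneg : ∀ᵐ x, 0 ≤ u x
  bounded : eLpNorm u ⊤ volume ≤ ENNReal.ofReal M
  mass : ∫ x, u x = m

/-- `u` minimizes the interaction energy among the admissible densities. -/
structure IsMinimizer (n : ℕ) (p q m M : ℝ) (u : EuclideanSpace ℝ (Fin n) → ℝ) : Prop where
  admissible : IsAdmissible n q m M u
  le_energy : ∀ v, IsAdmissible n q m M v →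
    interactionEnergy n p q u ≤ interactionEnergy n p q v

/-- The function `M · 1_{‖x‖ ≤ a}` on `ℝⁿ`. -/
def ballDensity (n : ℕ) (M a : ℝ) : EuclideanSpace ℝ (Fin n) → ℝ :=
  (Metric.closedBall (0 : EuclideanSpace ℝ (Fin n)) a).indicator fun _ => M

/-- Every minimizer coincides almost everywhere with a translate of `u`. -/
def UniqueUpToTranslation (n : ℕ) (p q m M : ℝ) (u : EuclideanSpace ℝ (Fin n) → ℝ) : Prop :=
  ∀ v, IsMinimizer n p q m M v →
    ∃ c : EuclideanSpace ℝ (Fin n), v =ᵐ[volume] fun x => u (x - c)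

end

/-! Write u for the ball density, v for a competitor and σ = v - u. The energy is quadratic, so E(v)
= E(u) + 2⟨σ, K ∗ u⟩ + ⟨σ, K ∗ σ⟩.

The linear term is nonnegative by a bathtub argument. The potential K ∗ u is radial. If it is at
most its value on the sphere ‖x‖ = a inside the ball and at least that value outside
(`EulerLagrangeBall`), then σ ≤ 0 inside, σ ≥ 0 outside and ∫ σ = 0 give ⟨σ, K ∗ u⟩ ≥ 0
(`EulerLagrangeBall.pairing_add_le`).

The quadratic term is nonnegative once v is translated so that its centre of mass is 0. Then σ has
zero mass and zero first moment, so constants and ‖z‖² contribute nothing to ⟨σ, K ∗ σ⟩. Gaussians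
are positive definite by Fourier inversion. The Coulomb kernel is a superposition of Gaussians, ‖z‖³
is a superposition of the remainders e^(-t‖z‖²) - 1 + t‖z‖², and ‖z‖⁴ is a limit of multiples of
them. The Coulomb part is strictly positive: its form vanishes only if the Fourier transform of σ
does, that is if σ = 0 a.e. This gives uniqueness up to translation
(`EulerLagrangeBall.isMinimizer_and_unique`).

It remains to find the potential explicitly, by slicing the ball perpendicular to the axis through
x. In all three cases the stated threshold is the condition that the potential at the centre does
not exceed its value on the sphere. Above the threshold the explicit formulas give all the
Euler–Lagrange inequalities. Below it, moving a little mass from near the centre to a thin shell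
just outside the ball lowers the energy to first order (`not_isMinimizer_of_tendsto`). -/

noncomputable section

/-! ### The bilinear interaction form and its absolute convergence -/

section Pairing

variable {E : Type*} [NormedAddCommGroup E] [InnerProductSpace ℝ E] [FiniteDimensional ℝ E]
  [MeasurableSpace E] [BorelSpace E]

/-- The bilinear form `∫∫ k(x - y) f(x) g(y) dx dy`. -/
def pairing (k f g : E → ℝ) : ℝ :=
  ∫ z : E × E, k (z.1 - z.2) * (f z.1 * g z.2)

/-- Absolute convergence of the integral defining `pairing k f g`. -/
def PairingIntegrable (k f g : E → ℝ) : Prop :=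
  Integrable fun z : E × E => k (z.1 - z.2) * (f z.1 * g z.2)

/-- Essentially bounded integrable functions with an absolutely convergent `q`-th moment. -/
structure HasMoment (q : ℕ) (f : E → ℝ) : Prop where
  integrable : Integrable f
  moment : Integrable fun x => ‖x‖ ^ q * f x
  bounded : ∃ C, ∀ᵐ x, |f x| ≤ C

theorem HasMoment.integrable_pow_mul {q j : ℕ} {f : E → ℝ} (hf : HasMoment q f) (hj : j ≤ q) :
    Integrable fun x => ‖x‖ ^ j * f x := by
  refine (hf.integrable.norm.add hf.moment.norm).mono'
    ((by fun_prop : AEStronglyMeasurable (fun x : E => ‖x‖ ^ j)).mul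
      hf.integrable.aestronglyMeasurable) (Filter.Eventually.of_forall fun x => ?_)
  have h : ‖x‖ ^ j ≤ 1 + ‖x‖ ^ q := by
    rcases le_total ‖x‖ 1 with h | h
    · have := pow_le_one₀ (n := j) (norm_nonneg x) h
      have := pow_nonneg (norm_nonneg x) q
      linarith
    · have := pow_le_pow_right₀ h hj
      linarith
  simp only [Pi.add_apply, norm_mul, norm_pow, norm_norm]
  nlinarith [norm_nonneg (f x)]

theorem HasMoment.mono {q j : ℕ} {f : E → ℝ} (hf : HasMoment q f) (hj : j ≤ q) : HasMoment j f :=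
  ⟨hf.integrable, hf.integrable_pow_mul hj, hf.bounded⟩

theorem HasMoment.add_const_mul {q : ℕ} {f g : E → ℝ} (hf : HasMoment q f) (hg : HasMoment q g)
    (s : ℝ) : HasMoment q fun x => f x + s * g x := by
  refine ⟨hf.integrable.add (hg.integrable.const_mul s), ?_, ?_⟩
  · refine (hf.moment.add (hg.moment.const_mul s)).congr (Filter.Eventually.of_forall fun x => ?_)
    simp only [Pi.add_apply]
    ring
  · obtain ⟨C, hC⟩ := hf.bounded
    obtain ⟨D, hD⟩ := hg.bounded
    refine ⟨C + |s| * D, ?_⟩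
    filter_upwards [hC, hD] with x h1 h2
    calc |f x + s * g x| ≤ |f x| + |s * g x| := abs_add_le _ _
      _ ≤ C + |s| * D := by
        rw [abs_mul]
        gcongr

theorem HasMoment.sub {q : ℕ} {f g : E → ℝ} (hf : HasMoment q f) (hg : HasMoment q g) :
    HasMoment q fun x => f x - g x := by
  simpa [sub_eq_add_neg] using hf.add_const_mul hg (-1)

theorem HasMoment.comp_add_right {q : ℕ} {f : E → ℝ} (hf : HasMoment q f) (c : E) :
    HasMoment q fun x => f (x + c) := by
  refine ⟨hf.integrable.comp_add_right c, ?_, ?_⟩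
  · have h1 := ((hf.moment.comp_add_right c).norm.const_mul (2 ^ (q - 1))).add
      ((hf.integrable.comp_add_right c).norm.const_mul (2 ^ (q - 1) * ‖c‖ ^ q))
    refine h1.mono' ((by fun_prop : AEStronglyMeasurable (fun x : E => ‖x‖ ^ q)).mul
      (hf.integrable.comp_add_right c).aestronglyMeasurable) (Filter.Eventually.of_forall fun x => ?_)
    have h2 : ‖x‖ ^ q ≤ 2 ^ (q - 1) * (‖x + c‖ ^ q + ‖c‖ ^ q) := by
      refine le_trans ?_ (add_pow_le (norm_nonneg _) (norm_nonneg _) q)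
      gcongr
      simpa using norm_sub_le (x + c) c
    simp only [Pi.add_apply, norm_mul, norm_pow, norm_norm]
    nlinarith [norm_nonneg (f (x + c))]
  · obtain ⟨C, hC⟩ := hf.bounded
    exact ⟨C, (measurePreserving_add_right volume c).quasiMeasurePreserving.ae hC⟩

theorem pairingIntegrable_one {f g : E → ℝ} (hf : Integrable f) (hg : Integrable g) :
    PairingIntegrable (fun _ : E => 1) f g := by
  simpa [PairingIntegrable, Measure.volume_eq_prod] using hf.mul_prod hg

theorem PairingIntegrable.mono {k k' f g : E → ℝ} (hk : PairingIntegrable k' f g)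
    (hm : Measurable k) (hf : AEStronglyMeasurable f) (hg : AEStronglyMeasurable g)
    (h : ∀ z, |k z| ≤ |k' z|) : PairingIntegrable k f g := by
  refine Integrable.mono hk ?_ (Filter.Eventually.of_forall fun z => ?_)
  · exact (hm.comp (measurable_fst.sub measurable_snd)).aestronglyMeasurable.mul
      (hf.comp_fst.mul hg.comp_snd)
  · rw [norm_mul, norm_mul (k' _)]
    gcongr
    exact h _

theorem PairingIntegrable.add {k k' f g : E → ℝ} (hk : PairingIntegrable k f g)
    (hk' : PairingIntegrable k' f g) : PairingIntegrable (fun z => k z + k' z) f g := by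
  simp only [PairingIntegrable, add_mul]
  exact Integrable.add hk hk'

theorem PairingIntegrable.const_mul {k f g : E → ℝ} (hk : PairingIntegrable k f g) (c : ℝ) :
    PairingIntegrable (fun z => c * k z) f g := by
  simpa [PairingIntegrable, mul_assoc] using Integrable.const_mul hk c

theorem pairing_add_kernel {k k' f g : E → ℝ} (hk : PairingIntegrable k f g)
    (hk' : PairingIntegrable k' f g) :
    pairing (fun z => k z + k' z) f g = pairing k f g + pairing k' f g := by
  simpa [pairing, add_mul] using integral_add hk hk'

theorem pairing_const_mul_kernel (k f g : E → ℝ) (c : ℝ) :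
    pairing (fun z => c * k z) f g = c * pairing k f g := by
  simp only [pairing, mul_assoc, integral_const_mul]

theorem pairingIntegrable_norm_pow {q : ℕ} {f g : E → ℝ} (hf : HasMoment q f)
    (hg : HasMoment q g) : PairingIntegrable (fun z => ‖z‖ ^ q) f g := by
  have h1 := (hf.moment.norm.mul_prod hg.integrable.norm).add
    (hf.integrable.norm.mul_prod hg.moment.norm)
  refine (h1.const_mul (2 ^ (q - 1))).mono' ?_ (Filter.Eventually.of_forall fun z => ?_)
  · exact (by fun_prop : AEStronglyMeasurable (fun z : E × E => ‖z.1 - z.2‖ ^ q)).mul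
      (hf.integrable.aestronglyMeasurable.comp_fst.mul hg.integrable.aestronglyMeasurable.comp_snd)
  · have h2 : ‖z.1 - z.2‖ ^ q ≤ 2 ^ (q - 1) * (‖z.1‖ ^ q + ‖z.2‖ ^ q) := by
      refine le_trans ?_ (add_pow_le (norm_nonneg _) (norm_nonneg _) q)
      gcongr
      exact norm_sub_le _ _
    simp only [Pi.add_apply, norm_mul, norm_pow, norm_norm]
    calc ‖z.1 - z.2‖ ^ q * (‖f z.1‖ * ‖g z.2‖)
        ≤ (2 ^ (q - 1) * (‖z.1‖ ^ q + ‖z.2‖ ^ q)) * (‖f z.1‖ * ‖g z.2‖) := by gcongr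
      _ = _ := by ring

/-- The integrable part `k₁` of the kernel is absorbed by the bound on `f`, leaving the integrand of
the convolution of `g` with `k₁`. The bounded part only needs `f` and `g` integrable. -/
theorem pairingIntegrable_of_integrable_add_bounded {k k₁ f g : E → ℝ} (hk : Measurable k)
    (h1 : Integrable k₁) (hle : ∀ z, |k z| ≤ |k₁ z| + 1) (hf : Integrable f) (hg : Integrable g)
    (hb : ∃ C, ∀ᵐ x, |f x| ≤ C) : PairingIntegrable k f g := by
  obtain ⟨C, hC⟩ := hb
  have hconv := (hg.norm.convolution_integrand (ContinuousLinearMap.mul ℝ ℝ) h1.norm).const_mul C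
  refine (hconv.add (hf.norm.mul_prod hg.norm)).mono' ?_ ?_
  · exact (hk.comp (measurable_fst.sub measurable_snd)).aestronglyMeasurable.mul
      (hf.aestronglyMeasurable.comp_fst.mul hg.aestronglyMeasurable.comp_snd)
  · filter_upwards [Measure.quasiMeasurePreserving_fst.ae hC] with z hz
    simp only [Pi.add_apply, norm_mul, Real.norm_eq_abs, ContinuousLinearMap.mul_apply']
    have h3 := hle (z.1 - z.2)
    have h4 := abs_nonneg (f z.1)
    have h5 := abs_nonneg (g z.2)
    calc |k (z.1 - z.2)| * (|f z.1| * |g z.2|)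
        ≤ (|k₁ (z.1 - z.2)| + 1) * (|f z.1| * |g z.2|) := by gcongr
      _ = (|g z.2| * |k₁ (z.1 - z.2)|) * |f z.1| + |f z.1| * |g z.2| := by ring
      _ ≤ (|g z.2| * |k₁ (z.1 - z.2)|) * C + |f z.1| * |g z.2| := by gcongr
      _ = _ := by ring

theorem pairing_comm {k : E → ℝ} (hk : ∀ z, k (-z) = k z) (f g : E → ℝ) :
    pairing k f g = pairing k g f := by
  unfold pairing
  rw [Measure.volume_eq_prod, ← integral_prod_swap]
  refine integral_congr_ae (Filter.Eventually.of_forall fun z => ?_)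
  simp only [Prod.fst_swap, Prod.snd_swap]
  rw [← hk, neg_sub, mul_comm (f z.2)]

theorem pairing_eq_integral_potential {k f g : E → ℝ} (h : PairingIntegrable k f g) :
    pairing k f g = ∫ x, (∫ y, k (x - y) * g y) * f x := by
  unfold pairing
  rw [Measure.volume_eq_prod, integral_prod _ h]
  refine integral_congr_ae (Filter.Eventually.of_forall fun x => ?_)
  simp only
  rw [← integral_mul_const]
  exact integral_congr_ae (Filter.Eventually.of_forall fun y => by ring)

theorem integrable_potential_mul {k f g : E → ℝ} (h : PairingIntegrable k f g) :
    Integrable fun x => (∫ y, k (x - y) * g y) * f x := by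
  refine (Integrable.integral_prod_left h).congr (Filter.Eventually.of_forall fun x => ?_)
  simp only
  rw [← integral_mul_const]
  exact integral_congr_ae (Filter.Eventually.of_forall fun y => by ring)

theorem pairing_add_const_mul_self {k f g : E → ℝ} (hk : ∀ z, k (-z) = k z)
    (hff : PairingIntegrable k f f) (hfg : PairingIntegrable k f g)
    (hgf : PairingIntegrable k g f) (hgg : PairingIntegrable k g g) (s : ℝ) :
    pairing k (fun x => f x + s * g x) (fun x => f x + s * g x)
      = pairing k f f + 2 * s * pairing k g f + s ^ 2 * pairing k g g := by
  have h : pairing k (fun x => f x + s * g x) (fun x => f x + s * g x)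
      = pairing k f f + s * pairing k f g + s * pairing k g f + s ^ 2 * pairing k g g := by
    unfold pairing
    rw [← integral_const_mul, ← integral_const_mul, ← integral_const_mul,
      ← integral_add hff (Integrable.const_mul hfg s), ← integral_add _ (Integrable.const_mul hgf s),
      ← integral_add _ (Integrable.const_mul hgg (s ^ 2))]
    · exact integral_congr_ae (Filter.Eventually.of_forall fun z => by ring)
    · exact (Integrable.add hff (Integrable.const_mul hfg s)).add (Integrable.const_mul hgf s)
    · exact Integrable.add hff (Integrable.const_mul hfg s)
  rw [h, pairing_comm hk f g]
  ring

end Pairing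

/-- Euclidean three-space. -/
abbrev E3 := EuclideanSpace ℝ (Fin 3)

/-- In polar coordinates the Jacobian r² cancels the singularity 1/r. -/
theorem integrable_indicator_ball_norm_inv :
    Integrable fun x : E3 => if ‖x‖ ≤ 1 then ‖x‖⁻¹ else 0 := by
  rw [integrable_fun_norm_addHaar volume (f := fun r : ℝ => if r ≤ 1 then r⁻¹ else 0)]
  have h1 : IntegrableOn (fun _ : ℝ => (1 : ℝ)) (Set.Ioc 0 1) := by simp
  have h2 : IntegrableOn (fun r : ℝ => r ^ 2 * if r ≤ 1 then r⁻¹ else 0) (Set.Ioc 0 1) := by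
    refine Integrable.mono' h1 (Measurable.aestronglyMeasurable ?_) ?_
    · exact (measurable_id.pow_const 2).mul
        (Measurable.ite measurableSet_Iic measurable_inv measurable_const)
    · filter_upwards [ae_restrict_mem measurableSet_Ioc] with r hr
      rw [if_pos hr.2, pow_two, mul_assoc, mul_inv_cancel₀ hr.1.ne', mul_one, Real.norm_eq_abs,
        abs_of_pos hr.1]
      exact hr.2
  have h3 : IntegrableOn (fun r : ℝ => r ^ 2 * if r ≤ 1 then r⁻¹ else 0) (Set.Ioi 1) := by
    refine (integrableOn_zero (μ := volume) (ε' := ℝ)).congr_fun (fun r hr => ?_) measurableSet_Ioi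
    rw [if_neg (not_le.2 hr), mul_zero]
  have h4 := h2.union h3
  rw [Set.Ioc_union_Ioi_eq_Ioi zero_le_one] at h4
  simpa using h4

theorem pairingIntegrable_norm_inv {f g : E3 → ℝ} (hf : HasMoment 0 f) (hg : HasMoment 0 g) :
    PairingIntegrable (fun z => ‖z‖⁻¹) f g := by
  refine pairingIntegrable_of_integrable_add_bounded (by fun_prop)
    integrable_indicator_ball_norm_inv (fun z => ?_) hf.integrable hg.integrable hf.bounded
  rw [abs_of_nonneg (inv_nonneg.2 (norm_nonneg z))]
  split_ifs with h
  · rw [abs_of_nonneg (inv_nonneg.2 (norm_nonneg z))]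
    linarith
  · simp only [abs_zero, zero_add]
    exact inv_le_one_of_one_le₀ (not_le.1 h).le

/-! ### Positive definiteness of Gaussians via the Fourier transform -/

section Positivity

variable {E : Type*} [NormedAddCommGroup E] [InnerProductSpace ℝ E] [FiniteDimensional ℝ E]
  [MeasurableSpace E] [BorelSpace E]

/-- A Gaussian is the Fourier transform of a Gaussian, here with b = 1/(4t). Taking real parts turns
the complex exponential into a cosine. -/
theorem exists_gaussian_eq_integral_cos {t : ℝ} (ht : 0 < t) :
    ∃ b > 0, ∃ c > 0, ∀ z : E, rexp (-(t * ‖z‖ ^ 2))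
      = c * ∫ ξ : E, rexp (-(b * ‖ξ‖ ^ 2)) * cos (inner ℝ z ξ) := by
  have hb : 0 < 1 / (4 * t) := by positivity
  set b := 1 / (4 * t) with hbdef
  have hA : 0 < (π / b) ^ ((Module.finrank ℝ E : ℝ) / 2) := by positivity
  refine ⟨b, hb, ((π / b) ^ ((Module.finrank ℝ E : ℝ) / 2))⁻¹, inv_pos.2 hA, fun z => ?_⟩
  have h1 := GaussianFourier.integral_cexp_neg_mul_sq_norm_add (V := E) (b := (b : ℂ))
    (by simpa using hb) Complex.I z
  have h2 := GaussianFourier.integrable_cexp_neg_mul_sq_norm_add (V := E) (b := (b : ℂ))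
    (by simpa using hb) Complex.I z
  have h3 := congrArg Complex.re h1
  rw [← RCLike.re_eq_complex_re, ← integral_re h2] at h3
  have h4 : ∀ ξ : E, RCLike.re (Complex.exp (-(b : ℂ) * ↑‖ξ‖ ^ 2 + Complex.I * ↑(inner ℝ z ξ)))
      = rexp (-(b * ‖ξ‖ ^ 2)) * cos (inner ℝ z ξ) := by
    intro ξ
    have : -(b : ℂ) * ↑‖ξ‖ ^ 2 + Complex.I * ↑(inner ℝ z ξ)
      = ((-(b * ‖ξ‖ ^ 2) : ℝ) : ℂ) + ((inner ℝ z ξ : ℝ) : ℂ) * Complex.I := by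
      push_cast; ring
    rw [this, RCLike.re_eq_complex_re, Complex.exp_re]
    simp [-Complex.ofReal_neg, -Complex.ofReal_mul, -Complex.ofReal_pow]
  simp_rw [h4] at h3
  have h5 : (((π : ℂ) / b) ^ ((Module.finrank ℝ E : ℂ) / 2)
      * Complex.exp (Complex.I ^ 2 * ↑‖z‖ ^ 2 / (4 * b)))
      = (((π / b) ^ ((Module.finrank ℝ E : ℝ) / 2) * rexp (-(t * ‖z‖ ^ 2)) : ℝ) : ℂ) := by
    rw [Complex.ofReal_mul, Complex.ofReal_cpow (by positivity), Complex.ofReal_exp]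
    push_cast
    congr 2
    rw [hbdef, Complex.I_sq]
    push_cast
    field_simp
  rw [h5, RCLike.re_eq_complex_re, Complex.ofReal_re] at h3
  rw [h3, inv_mul_cancel_left₀ hA.ne']

/-- The squared modulus of the Fourier integral of `f` at the frequency `ξ`. -/
def fourierSq (f : E → ℝ) (ξ : E) : ℝ :=
  (∫ x, cos (inner ℝ x ξ) * f x) ^ 2 + (∫ x, sin (inner ℝ x ξ) * f x) ^ 2

theorem integrable_cos_inner_mul {f : E → ℝ} (hf : Integrable f) (ξ : E) :
    Integrable fun x => cos (inner ℝ x ξ) * f x := by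
  refine hf.norm.mono' ((by fun_prop : AEStronglyMeasurable (fun x : E => cos (inner ℝ x ξ))).mul
    hf.aestronglyMeasurable) (Filter.Eventually.of_forall fun x => ?_)
  rw [norm_mul]
  exact mul_le_of_le_one_left (norm_nonneg _) (abs_cos_le_one _)

theorem integrable_sin_inner_mul {f : E → ℝ} (hf : Integrable f) (ξ : E) :
    Integrable fun x => sin (inner ℝ x ξ) * f x := by
  refine hf.norm.mono' ((by fun_prop : AEStronglyMeasurable (fun x : E => sin (inner ℝ x ξ))).mul
    hf.aestronglyMeasurable) (Filter.Eventually.of_forall fun x => ?_)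
  rw [norm_mul]
  exact mul_le_of_le_one_left (norm_nonneg _) (abs_sin_le_one _)

/-- The addition formula for cos(⟨x, ξ⟩ - ⟨y, ξ⟩) separates the variables into a sum of two squares.
-/
theorem pairing_cos_inner {f : E → ℝ} (hf : Integrable f) (ξ : E) :
    pairing (fun z => cos (inner ℝ z ξ)) f f = fourierSq f ξ := by
  have hc := integrable_cos_inner_mul hf ξ
  have hs := integrable_sin_inner_mul hf ξ
  unfold pairing fourierSq
  rw [pow_two, pow_two, ← integral_prod_mul, ← integral_prod_mul,
    ← integral_add (hc.mul_prod hc) (hs.mul_prod hs), Measure.volume_eq_prod]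
  refine integral_congr_ae (Filter.Eventually.of_forall fun z => ?_)
  simp only [inner_sub_left, cos_sub]
  ring

theorem continuous_fourierSq {f : E → ℝ} (hf : Integrable f) : Continuous (fourierSq f) := by
  unfold fourierSq
  refine ((continuous_of_dominated (bound := fun x => ‖f x‖) (fun ξ =>
    (integrable_cos_inner_mul hf ξ).aestronglyMeasurable) (fun ξ => ?_) hf.norm ?_).pow 2).add
    ((continuous_of_dominated (bound := fun x => ‖f x‖) (fun ξ =>
    (integrable_sin_inner_mul hf ξ).aestronglyMeasurable) (fun ξ => ?_) hf.norm ?_).pow 2)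
  · refine Filter.Eventually.of_forall fun x => ?_
    rw [norm_mul]
    exact mul_le_of_le_one_left (norm_nonneg _) (abs_cos_le_one _)
  · exact Filter.Eventually.of_forall fun x => by fun_prop
  · refine Filter.Eventually.of_forall fun x => ?_
    rw [norm_mul]
    exact mul_le_of_le_one_left (norm_nonneg _) (abs_sin_le_one _)
  · exact Filter.Eventually.of_forall fun x => by fun_prop

theorem fourierSq_nonneg (f : E → ℝ) (ξ : E) : 0 ≤ fourierSq f ξ := by
  unfold fourierSq; positivity

theorem integrable_gaussian {b : ℝ} (hb : 0 < b) :
    Integrable fun ξ : E => rexp (-(b * ‖ξ‖ ^ 2)) := by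
  have h := (GaussianFourier.integrable_cexp_neg_mul_sq_norm_add (V := E) (b := (b : ℂ))
    (by simpa using hb) 0 0).norm
  refine h.congr (Filter.Eventually.of_forall fun ξ => ?_)
  simp only [Complex.norm_exp]
  congr 1
  have : -(b : ℂ) * ↑‖ξ‖ ^ 2 + 0 * ↑(inner ℝ (0 : E) ξ) = ((-(b * ‖ξ‖ ^ 2) : ℝ) : ℂ) := by
    push_cast; ring
  rw [this, Complex.ofReal_re]

theorem exists_pairing_gaussian_eq {t : ℝ} (ht : 0 < t) {f : E → ℝ} (hf : Integrable f) :
    ∃ b > 0, ∃ c > 0, pairing (fun z => rexp (-(t * ‖z‖ ^ 2))) f f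
      = c * ∫ ξ, rexp (-(b * ‖ξ‖ ^ 2)) * fourierSq f ξ := by
  obtain ⟨b, hb, c, hc, h⟩ := exists_gaussian_eq_integral_cos (E := E) ht
  refine ⟨b, hb, c, hc, ?_⟩
  have hint : Integrable (Function.uncurry fun (z : E × E) (ξ : E) =>
      rexp (-(b * ‖ξ‖ ^ 2)) * cos (inner ℝ (z.1 - z.2) ξ) * (f z.1 * f z.2))
      ((volume : Measure (E × E)).prod volume) := by
    have h1 : Integrable (fun z : E × E => f z.1 * f z.2) := hf.mul_prod hf
    refine (h1.norm.mul_prod (integrable_gaussian (E := E) hb)).mono' ?_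
      (Filter.Eventually.of_forall fun p => ?_)
    · exact AEStronglyMeasurable.mul (by fun_prop) h1.aestronglyMeasurable.comp_fst
    · simp only [Function.uncurry, norm_mul, Real.norm_eq_abs, abs_exp]
      calc _ ≤ rexp (-(b * ‖p.2‖ ^ 2)) * 1 * (|f p.1.1| * |f p.1.2|) := by
            gcongr; exact abs_cos_le_one _
        _ = _ := by ring
  calc pairing (fun z => rexp (-(t * ‖z‖ ^ 2))) f f
      = c * ∫ z : E × E, ∫ ξ : E,
          rexp (-(b * ‖ξ‖ ^ 2)) * cos (inner ℝ (z.1 - z.2) ξ) * (f z.1 * f z.2) := by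
        unfold pairing
        rw [← integral_const_mul]
        refine integral_congr_ae (Filter.Eventually.of_forall fun z => ?_)
        simp only
        rw [h, integral_mul_const]
        ring
    _ = c * ∫ ξ, rexp (-(b * ‖ξ‖ ^ 2)) * fourierSq f ξ := by
        rw [integral_integral_swap hint]
        congr 1
        refine integral_congr_ae (Filter.Eventually.of_forall fun ξ => ?_)
        simp only
        rw [← pairing_cos_inner hf, pairing, ← integral_const_mul]
        exact integral_congr_ae (Filter.Eventually.of_forall fun z => by ring)

theorem pairing_gaussian_nonneg {t : ℝ} (ht : 0 < t) {f : E → ℝ} (hf : Integrable f) :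
    0 ≤ pairing (fun z => rexp (-(t * ‖z‖ ^ 2))) f f := by
  obtain ⟨b, hb, c, hc, h⟩ := exists_pairing_gaussian_eq ht hf
  rw [h]
  exact mul_nonneg hc.le (integral_nonneg fun ξ => mul_nonneg (exp_pos _).le (fourierSq_nonneg f ξ))

theorem fourierSq_le {f : E → ℝ} (hf : Integrable f) (ξ : E) :
    fourierSq f ξ ≤ 2 * (∫ x, ‖f x‖) ^ 2 := by
  have h1 : ‖∫ x, cos (inner ℝ x ξ) * f x‖ ≤ ∫ x, ‖f x‖ :=
    norm_integral_le_of_norm_le hf.norm (Filter.Eventually.of_forall fun x => by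
      rw [norm_mul]; exact mul_le_of_le_one_left (norm_nonneg _) (abs_cos_le_one _))
  have h2 : ‖∫ x, sin (inner ℝ x ξ) * f x‖ ≤ ∫ x, ‖f x‖ :=
    norm_integral_le_of_norm_le hf.norm (Filter.Eventually.of_forall fun x => by
      rw [norm_mul]; exact mul_le_of_le_one_left (norm_nonneg _) (abs_sin_le_one _))
  rw [Real.norm_eq_abs] at h1 h2
  have h3 := sq_le_sq' (by linarith [neg_abs_le (∫ x, cos (inner ℝ x ξ) * f x)])
    ((le_abs_self _).trans h1)
  have h4 := sq_le_sq' (by linarith [neg_abs_le (∫ x, sin (inner ℝ x ξ) * f x)])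
    ((le_abs_self _).trans h2)
  unfold fourierSq
  linarith

/-- A vanishing integral of a nonnegative function gives zero almost everywhere. Continuity of
`fourierSq f` upgrades this to every frequency. -/
theorem fourierSq_eq_zero_of_pairing_gaussian {t : ℝ} (ht : 0 < t) {f : E → ℝ} (hf : Integrable f)
    (h0 : pairing (fun z => rexp (-(t * ‖z‖ ^ 2))) f f = 0) (ξ : E) : fourierSq f ξ = 0 := by
  obtain ⟨b, hb, c, hc, h⟩ := exists_pairing_gaussian_eq ht hf
  rw [h0, zero_eq_mul, or_iff_right hc.ne'] at h
  have hcont : Continuous fun ξ : E => rexp (-(b * ‖ξ‖ ^ 2)) * fourierSq f ξ :=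
    (by fun_prop : Continuous fun ξ : E => rexp (-(b * ‖ξ‖ ^ 2))).mul (continuous_fourierSq hf)
  have hint : Integrable fun ξ : E => rexp (-(b * ‖ξ‖ ^ 2)) * fourierSq f ξ := by
    refine ((integrable_gaussian hb).mul_const (2 * (∫ x, ‖f x‖) ^ 2)).mono'
      hcont.aestronglyMeasurable (Filter.Eventually.of_forall fun ξ => ?_)
    rw [norm_mul, norm_of_nonneg (exp_pos _).le, norm_of_nonneg (fourierSq_nonneg f ξ)]
    gcongr
    exact fourierSq_le hf ξ
  rw [integral_eq_zero_iff_of_nonneg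
    (fun ξ => mul_nonneg (exp_pos _).le (fourierSq_nonneg f ξ)) hint] at h
  have h1 := congrFun ((hcont.ae_eq_iff_eq volume continuous_zero).1 h) ξ
  simpa using h1

/-- Fourier uniqueness, reduced to finite measures: the positive and negative parts of `f` are
densities of two measures with the same characteristic function, so they coincide. -/
theorem ae_eq_zero_of_fourierSq_eq_zero {f : E → ℝ} (hf : Integrable f)
    (h : ∀ ξ, fourierSq f ξ = 0) : f =ᵐ[volume] 0 := by
  have hm : AEMeasurable f := hf.aestronglyMeasurable.aemeasurable
  have hp := hf.lintegral_lt_top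
  have hf' : Integrable fun x => -f x := hf.neg
  have hn := hf'.lintegral_lt_top
  have := isFiniteMeasure_withDensity hp.ne
  have := isFiniteMeasure_withDensity hn.ne
  have hchar : ∀ {g : E → ℝ}, Integrable g → ∀ ξ : E,
      charFun (volume.withDensity fun x => ENNReal.ofReal (g x)) ξ
        = ∫ x, ((max (g x) 0 : ℝ) : ℂ) * Complex.exp (inner ℝ x ξ * Complex.I) := by
    intro g hg ξ
    rw [charFun_apply, integral_withDensity_eq_integral_toReal_smul₀
      hg.aestronglyMeasurable.aemeasurable.ennreal_ofReal
      (Filter.Eventually.of_forall fun x => ENNReal.ofReal_lt_top)]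
    refine integral_congr_ae (Filter.Eventually.of_forall fun x => ?_)
    simp [ENNReal.toReal_ofReal']
  have hbd : ∀ {g : E → ℝ}, Integrable g → ∀ ξ : E,
      Integrable fun x => ((g x : ℝ) : ℂ) * Complex.exp (inner ℝ x ξ * Complex.I) := by
    intro g hg ξ
    refine hg.norm.mono' (hg.ofReal.aestronglyMeasurable.mul (by fun_prop))
      (Filter.Eventually.of_forall fun x => ?_)
    rw [norm_mul, Complex.norm_exp_ofReal_mul_I, mul_one, Complex.norm_real]
  have hE : (volume.withDensity fun x => ENNReal.ofReal (f x))
      = volume.withDensity fun x => ENNReal.ofReal (-f x) := by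
    refine Measure.ext_of_charFun (funext fun ξ => ?_)
    rw [hchar hf, hchar hf', ← sub_eq_zero]
    rw [← integral_sub (hbd hf.pos_part ξ) (hbd hf'.pos_part ξ)]
    have h1 : ∀ x, ((max (f x) 0 : ℝ) : ℂ) * Complex.exp (inner ℝ x ξ * Complex.I)
        - ((max (-f x) 0 : ℝ) : ℂ) * Complex.exp (inner ℝ x ξ * Complex.I)
        = ((cos (inner ℝ x ξ) * f x : ℝ) : ℂ) + ((sin (inner ℝ x ξ) * f x : ℝ) : ℂ) * Complex.I := by
      intro x
      have h2 : max (f x) 0 - max (-f x) 0 = f x := by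
        rcases le_total (f x) 0 with h | h <;> simp [h]
      rw [← sub_mul, ← Complex.ofReal_sub, h2, Complex.exp_mul_I]
      push_cast
      ring
    simp_rw [h1]
    have hξ := h ξ
    unfold fourierSq at hξ
    have hc : ∫ x, cos (inner ℝ x ξ) * f x = 0 := by
      nlinarith [sq_nonneg (∫ x, cos (inner ℝ x ξ) * f x), sq_nonneg (∫ x, sin (inner ℝ x ξ) * f x)]
    have hs : ∫ x, sin (inner ℝ x ξ) * f x = 0 := by
      nlinarith [sq_nonneg (∫ x, cos (inner ℝ x ξ) * f x), sq_nonneg (∫ x, sin (inner ℝ x ξ) * f x)]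
    rw [integral_add (integrable_cos_inner_mul hf ξ).ofReal
      ((integrable_sin_inner_mul hf ξ).ofReal.mul_const _), integral_mul_const,
      integral_complex_ofReal, integral_complex_ofReal, hc, hs]
    simp
  rw [withDensity_eq_iff hm.ennreal_ofReal hf'.aestronglyMeasurable.aemeasurable.ennreal_ofReal hp.ne] at hE
  filter_upwards [hE] with x hx
  rcases le_total (f x) 0 with h | h
  · rw [ENNReal.ofReal_of_nonpos h] at hx
    have := ENNReal.ofReal_eq_zero.1 hx.symm
    simp only [Pi.zero_apply]
    linarith
  · have h' : -f x ≤ 0 := by linarith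
    rw [ENNReal.ofReal_of_nonpos h'] at hx
    have := ENNReal.ofReal_eq_zero.1 hx
    simp only [Pi.zero_apply]
    linarith

end Positivity

/-! ### Coulomb, cubic and quartic kernels built from Gaussians -/

section Superposition

variable {E : Type*} [NormedAddCommGroup E] [InnerProductSpace ℝ E] [FiniteDimensional ℝ E]
  [MeasurableSpace E] [BorelSpace E]

theorem ae_fst_sub_snd_ne_zero [Nontrivial E] :
    ∀ᵐ z : E × E, z.1 - z.2 ≠ 0 := by
  have h : ∀ᵐ x : E, x ≠ 0 := by
    simp [ae_iff]
  exact (quasiMeasurePreserving_sub (volume : Measure E) volume).ae h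

/-- Fubini. Since `h` is nonnegative, integrating absolute values over `t` returns the absolute
integrand of the pairing with `k`. The representation is needed only off the diagonal, which is
null. -/
theorem pairing_superposition [Nontrivial E] {k f g : E → ℝ} {h : ℝ → E → ℝ} {S : Set ℝ}
    (hS : MeasurableSet S) (hm : Measurable (Function.uncurry h))
    (hnn : ∀ t ∈ S, ∀ z, 0 ≤ h t z)
    (hint : ∀ z, z ≠ 0 → IntegrableOn (fun t => h t z) S)
    (hk : ∀ z, z ≠ 0 → k z = ∫ t in S, h t z)
    (hf : AEStronglyMeasurable f) (hg : AEStronglyMeasurable g) (hki : PairingIntegrable k f g) :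
    IntegrableOn (fun t => pairing (h t) f g) S ∧
      pairing k f g = ∫ t in S, pairing (h t) f g := by
  have hI : Integrable (Function.uncurry fun (z : E × E) (t : ℝ) =>
      h t (z.1 - z.2) * (f z.1 * g z.2)) ((volume : Measure (E × E)).prod (volume.restrict S)) := by
    rw [integrable_prod_iff]
    · refine ⟨?_, ?_⟩
      · filter_upwards [ae_fst_sub_snd_ne_zero] with z hz
        exact Integrable.mul_const (hint _ hz) (f z.1 * g z.2)
      · refine hki.norm.congr ?_
        filter_upwards [ae_fst_sub_snd_ne_zero] with z hz
        rw [norm_mul, hk _ hz, Real.norm_of_nonneg (setIntegral_nonneg hS fun t ht => hnn t ht _),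
          ← integral_mul_const]
        refine setIntegral_congr_fun hS fun t ht => ?_
        simp only [Function.uncurry]
        rw [norm_mul (h t (z.1 - z.2)), Real.norm_of_nonneg (hnn t ht _)]
    · refine AEStronglyMeasurable.mul (Measurable.aestronglyMeasurable ?_)
        (hf.comp_fst.mul hg.comp_snd).comp_fst
      exact hm.comp (measurable_snd.prodMk
        ((measurable_fst.comp measurable_fst).sub (measurable_snd.comp measurable_fst)))
  refine ⟨hI.integral_prod_right, ?_⟩
  have h1 := integral_integral_swap hI
  unfold pairing
  rw [← h1]
  refine integral_congr_ae ?_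
  filter_upwards [ae_fst_sub_snd_ne_zero] with z hz
  rw [hk _ hz, ← integral_mul_const]

theorem rpow_neg_half_integral {s : ℝ} (hs : 0 < s) :
    IntegrableOn (fun t : ℝ => t ^ (-(1 / 2) : ℝ) * rexp (-(t * s ^ 2))) (Set.Ioi 0) ∧
    ∫ t in Set.Ioi (0 : ℝ), t ^ (-(1 / 2) : ℝ) * rexp (-(t * s ^ 2)) = Gamma (1 / 2) * s⁻¹ := by
  have h := integral_rpow_mul_exp_neg_mul_Ioi (a := 1 / 2) (r := s ^ 2) (by norm_num) (by positivity)
  have h1 : ∫ t in Set.Ioi (0 : ℝ), t ^ (-(1 / 2) : ℝ) * rexp (-(t * s ^ 2))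
      = Gamma (1 / 2) * s⁻¹ := by
    rw [mul_comm (Gamma _)]
    convert h using 1
    · simp_rw [mul_comm (s ^ 2)]
      norm_num
    · congr 1
      rw [← Real.sqrt_eq_rpow, one_div, Real.sqrt_inv, Real.sqrt_sq hs.le]
  refine ⟨?_, h1⟩
  -- The Bochner integral of a nonintegrable function is 0 by convention, so a positive value forces
  -- integrability.
  by_contra hn
  rw [integral_undef hn] at h1
  have : 0 < Gamma (1 / 2) * s⁻¹ := mul_pos (Gamma_pos_of_pos (by norm_num)) (inv_pos.2 hs)
  linarith

theorem gaussianRemainder_nonneg (s : ℝ) : 0 ≤ rexp (-s) - 1 + s := by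
  linarith [add_one_le_exp (-s)]

theorem gaussianRemainder_le {s : ℝ} (hs : 0 ≤ s) : rexp (-s) - 1 + s ≤ s ^ 2 / 2 := by
  have h := quadratic_le_exp_of_nonneg hs
  have h1 : rexp (-s) * rexp s = 1 := by rw [← exp_add]; simp
  have h2 : rexp (-s) * (1 + s + s ^ 2 / 2) ≤ 1 := by
    refine le_trans ?_ h1.le
    gcongr
  have h3 : 0 < 1 + s + s ^ 2 / 2 := by positivity
  -- The point is (1 - s + s²/2)(1 + s + s²/2) = 1 + s⁴/4 ≥ 1.
  nlinarith [sq_nonneg (s ^ 2), exp_pos (-s)]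

theorem gaussianRemainder_le_self {s : ℝ} (hs : 0 ≤ s) : rexp (-s) - 1 + s ≤ s := by
  linarith [exp_le_one_iff.2 (neg_nonpos.2 hs)]

/-- The constant `∫ t^(-5/2) (e^(-t) - 1 + t) dt` over the positive half-line. -/
def cubicConst : ℝ := ∫ t in Set.Ioi (0 : ℝ), t ^ (-(5 / 2) : ℝ) * (rexp (-t) - 1 + t)

/-- The remainder is at most t²/2 near 0 and at most t at infinity, so the integrand is dominated by
t^(-1/2) and t^(-3/2) respectively. -/
theorem integrableOn_cubicConst :
    IntegrableOn (fun t : ℝ => t ^ (-(5 / 2) : ℝ) * (rexp (-t) - 1 + t)) (Set.Ioi 0) := by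
  have hm : Measurable fun t : ℝ => t ^ (-(5 / 2) : ℝ) * (rexp (-t) - 1 + t) := by fun_prop
  rw [← Set.Ioc_union_Ioi_eq_Ioi (zero_le_one' ℝ)]
  refine IntegrableOn.union ?_ ?_
  · have h1 : IntegrableOn (fun t : ℝ => t ^ (-(1 / 2) : ℝ)) (Set.Ioc 0 1) := by
      rw [← intervalIntegrable_iff_integrableOn_Ioc_of_le zero_le_one]
      exact intervalIntegral.intervalIntegrable_rpow' (by norm_num)
    refine Integrable.mono' h1 hm.aestronglyMeasurable ?_
    filter_upwards [ae_restrict_mem measurableSet_Ioc] with t ht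
    have h0 : 0 < t := ht.1
    rw [Real.norm_of_nonneg (mul_nonneg (rpow_nonneg h0.le _) (gaussianRemainder_nonneg t))]
    have h2 : t ^ (-(1 / 2) : ℝ) = t ^ (-(5 / 2) : ℝ) * t ^ 2 := by
      rw [← rpow_natCast, ← rpow_add h0]; norm_num
    rw [h2]
    gcongr
    have := gaussianRemainder_le h0.le
    nlinarith [sq_nonneg t]
  · have h1 : IntegrableOn (fun t : ℝ => t ^ (-(3 / 2) : ℝ)) (Set.Ioi 1) :=
      integrableOn_Ioi_rpow_of_lt (by norm_num) one_pos
    refine Integrable.mono' h1 hm.aestronglyMeasurable ?_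
    filter_upwards [ae_restrict_mem measurableSet_Ioi] with t ht
    have h0 : 0 < t := lt_trans one_pos ht
    rw [Real.norm_of_nonneg (mul_nonneg (rpow_nonneg h0.le _) (gaussianRemainder_nonneg t))]
    have h2 : t ^ (-(3 / 2) : ℝ) = t ^ (-(5 / 2) : ℝ) * t := by
      rw [← rpow_add_one h0.ne']; norm_num
    rw [h2]
    gcongr
    exact gaussianRemainder_le_self h0.le

theorem cubicConst_pos : 0 < cubicConst := by
  unfold cubicConst
  rw [setIntegral_pos_iff_support_of_nonneg_ae _ integrableOn_cubicConst]
  · have : Set.Ioi (0 : ℝ) ⊆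
        Function.support fun t : ℝ => t ^ (-(5 / 2) : ℝ) * (rexp (-t) - 1 + t) := by
      intro t ht
      have h0 : (0 : ℝ) < t := ht
      have := add_one_lt_exp (neg_ne_zero.2 h0.ne')
      exact mul_ne_zero (rpow_pos_of_pos h0 _).ne' (by linarith)
    rw [Set.inter_eq_self_of_subset_right this]
    simp
  · filter_upwards [ae_restrict_mem measurableSet_Ioi] with t ht
    exact mul_nonneg (rpow_nonneg (le_of_lt ht) _) (gaussianRemainder_nonneg t)

/-- Substituting s²t for t pulls out s⁵ · s⁻² = s³. -/
theorem rpow_remainder_integral {s : ℝ} (hs : 0 < s) :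
    IntegrableOn (fun t : ℝ => t ^ (-(5 / 2) : ℝ) * (rexp (-(t * s ^ 2)) - 1 + t * s ^ 2))
      (Set.Ioi 0) ∧
    ∫ t in Set.Ioi (0 : ℝ), t ^ (-(5 / 2) : ℝ) * (rexp (-(t * s ^ 2)) - 1 + t * s ^ 2)
      = cubicConst * s ^ 3 := by
  have hs2 : 0 < s ^ 2 := by positivity
  set F : ℝ → ℝ := fun t => t ^ (-(5 / 2) : ℝ) * (rexp (-t) - 1 + t) with hF
  have h5 : (s ^ 2) ^ (-(5 / 2) : ℝ) = (s ^ 5)⁻¹ := by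
    rw [← rpow_natCast, ← rpow_mul hs.le, ← rpow_natCast s 5, ← rpow_neg hs.le]
    norm_num
  have h1 : Set.EqOn (fun t : ℝ => t ^ (-(5 / 2) : ℝ) * (rexp (-(t * s ^ 2)) - 1 + t * s ^ 2))
      (fun t => s ^ 5 * F (s ^ 2 * t)) (Set.Ioi 0) := by
    intro t ht
    have h0 : (0 : ℝ) < t := ht
    simp only [hF]
    rw [mul_rpow hs2.le h0.le, h5, mul_comm (s ^ 2) t]
    field_simp
  have h3 : IntegrableOn (fun t => F (s ^ 2 * t)) (Set.Ioi 0) := by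
    rw [integrableOn_Ioi_comp_mul_left_iff F 0 hs2, mul_zero]
    exact integrableOn_cubicConst
  refine ⟨(integrableOn_congr_fun h1 measurableSet_Ioi).2 (Integrable.const_mul h3 _), ?_⟩
  rw [setIntegral_congr_fun measurableSet_Ioi h1, integral_const_mul,
    integral_comp_mul_left_Ioi F 0 hs2, mul_zero, smul_eq_mul]
  have : ∫ t in Set.Ioi (0 : ℝ), F t = cubicConst := rfl
  rw [this]
  field_simp

/-- Integrable functions with vanishing total mass and vanishing first moment. -/
structure IsNeutralCentered (f : E → ℝ) : Prop where
  mass : ∫ x, f x = 0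
  first_moment : ∫ x, f x • x = 0

theorem HasMoment.integrable_smul_self {q : ℕ} (hq : 1 ≤ q) {f : E → ℝ} (hf : HasMoment q f) :
    Integrable fun x => f x • x := by
  refine (hf.integrable_pow_mul hq).norm.mono'
    (hf.integrable.aestronglyMeasurable.smul aestronglyMeasurable_id)
    (Filter.Eventually.of_forall fun x => ?_)
  rw [norm_smul, pow_one, norm_mul, norm_norm, mul_comm]

/-- Expanding ‖x - y‖², zero mass kills the ‖x‖² term and zero first moment the cross term. The
potential is therefore constant in x, and pairs to 0 with a function of zero mass. -/
theorem pairing_norm_sq_eq_zero {f : E → ℝ} (hf : HasMoment 2 f) (hc : IsNeutralCentered f) :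
    pairing (fun z => ‖z‖ ^ 2) f f = 0 := by
  rw [pairing_eq_integral_potential (pairingIntegrable_norm_pow hf hf)]
  have h : ∀ x : E, ∫ y, ‖x - y‖ ^ 2 * f y = ∫ y, ‖y‖ ^ 2 * f y := by
    intro x
    have h1 : ∀ y : E, ‖x - y‖ ^ 2 * f y
        = ‖x‖ ^ 2 * f y - 2 * inner ℝ x (f y • y) + ‖y‖ ^ 2 * f y := by
      intro y
      rw [norm_sub_sq_real, inner_smul_right]
      ring
    have h2 := hf.integrable_smul_self one_le_two
    simp_rw [h1]
    rw [integral_add _ hf.moment, integral_sub (hf.integrable.const_mul _)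
      ((h2.const_inner x).const_mul 2), integral_const_mul, integral_const_mul,
      integral_inner h2, hc.mass, hc.first_moment]
    · simp
    · exact (hf.integrable.const_mul _).sub ((h2.const_inner x).const_mul 2)
  simp_rw [h]
  rw [integral_const_mul, hc.mass, mul_zero]

/-- On neutral centred functions the terms -1 and t‖z‖² are invisible, so the pairing equals that of
the Gaussian. -/
theorem pairing_gaussianRemainder_nonneg {f : E → ℝ} (hf : HasMoment 2 f)
    (hc : IsNeutralCentered f) {t : ℝ} (ht : 0 < t) :
    0 ≤ pairing (fun z => rexp (-(t * ‖z‖ ^ 2)) - 1 + t * ‖z‖ ^ 2) f f := by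
  have h1 := pairingIntegrable_one hf.integrable hf.integrable
  have h2 := (pairingIntegrable_norm_pow hf hf).const_mul t
  have h3 : PairingIntegrable (fun z => rexp (-(t * ‖z‖ ^ 2))) f f :=
    h1.mono (by fun_prop) hf.integrable.aestronglyMeasurable hf.integrable.aestronglyMeasurable
      fun z => by
        rw [abs_exp, abs_one, exp_le_one_iff, neg_nonpos]; positivity
  have h4 : pairing (fun _ : E => 1) f f = 0 := by
    simp only [pairing, one_mul]
    rw [Measure.volume_eq_prod, integral_prod_mul, hc.mass, mul_zero]
  have h5 : (fun z : E => rexp (-(t * ‖z‖ ^ 2)) - 1 + t * ‖z‖ ^ 2)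
      = fun z => (rexp (-(t * ‖z‖ ^ 2)) + (-1) * 1) + t * ‖z‖ ^ 2 := by
    funext z; ring
  rw [h5, pairing_add_kernel (h3.add (h1.const_mul (-1))) h2,
    pairing_add_kernel h3 (h1.const_mul (-1)), pairing_const_mul_kernel, pairing_const_mul_kernel,
    h4, pairing_norm_sq_eq_zero hf hc]
  simpa using pairing_gaussian_nonneg ht hf.integrable

theorem pairing_norm_cube_nonneg [Nontrivial E] {f : E → ℝ} (hf : HasMoment 3 f)
    (hc : IsNeutralCentered f) : 0 ≤ pairing (fun z => ‖z‖ ^ 3) f f := by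
  have h := (pairing_superposition (k := fun z : E => cubicConst * ‖z‖ ^ 3)
    (h := fun t z => t ^ (-(5 / 2) : ℝ) * (rexp (-(t * ‖z‖ ^ 2)) - 1 + t * ‖z‖ ^ 2))
    measurableSet_Ioi (by unfold Function.uncurry; fun_prop)
    (fun t ht z => mul_nonneg (rpow_nonneg (le_of_lt ht) _) (gaussianRemainder_nonneg _))
    (fun z hz => (rpow_remainder_integral (norm_pos_iff.2 hz)).1)
    (fun z hz => (rpow_remainder_integral (norm_pos_iff.2 hz)).2.symm)
    hf.integrable.aestronglyMeasurable hf.integrable.aestronglyMeasurable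
    ((pairingIntegrable_norm_pow hf hf).const_mul _)).2
  rw [pairing_const_mul_kernel] at h
  refine nonneg_of_mul_nonneg_right ?_ cubicConst_pos
  rw [h]
  refine setIntegral_nonneg measurableSet_Ioi fun t ht => ?_
  rw [pairing_const_mul_kernel]
  exact mul_nonneg (rpow_nonneg (le_of_lt ht) _)
    (pairing_gaussianRemainder_nonneg (hf.mono (by norm_num)) hc ht)

theorem tendsto_gaussianRemainder_div_sq (s : ℝ) :
    Filter.Tendsto (fun n : ℕ => 2 * ((n : ℝ) + 1) ^ 2
      * (rexp (-(1 / ((n : ℝ) + 1) * s)) - 1 + 1 / ((n : ℝ) + 1) * s)) Filter.atTop (nhds (s ^ 2)) := by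
  have hlim : Filter.Tendsto (fun n : ℕ => 1 / ((n : ℝ) + 1)) Filter.atTop (nhds 0) :=
    tendsto_one_div_add_atTop_nhds_zero_nat
  rw [tendsto_iff_norm_sub_tendsto_zero]
  have h0 : Filter.Tendsto (fun n : ℕ => (|s| ^ 3) * (1 / ((n : ℝ) + 1))) Filter.atTop (nhds 0) := by
    simpa using hlim.const_mul (|s| ^ 3)
  refine squeeze_zero' (Filter.Eventually.of_forall fun n => norm_nonneg _) ?_ h0
  have hs : Filter.Tendsto (fun n : ℕ => |-(1 / ((n : ℝ) + 1) * s)|) Filter.atTop (nhds 0) := by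
    simpa using ((hlim.mul_const s).neg).abs
  filter_upwards [hs.eventually_le_const one_pos] with n hn
  have h := Real.exp_bound hn (n := 3) (by norm_num)
  have hn0 : (0 : ℝ) < (n : ℝ) + 1 := by positivity
  set e := 1 / ((n : ℝ) + 1) with he
  have hen : ((n : ℝ) + 1) = e⁻¹ := by simp [he]
  have he0 : 0 < e := by positivity
  simp only [Finset.sum_range_succ, Finset.sum_range_zero, Nat.factorial] at h
  norm_num at h
  rw [hen, Real.norm_eq_abs]
  have h2 : 2 * e⁻¹ ^ 2 * (rexp (-(e * s)) - 1 + e * s) - s ^ 2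
      = 2 * e⁻¹ ^ 2 * (rexp (-(e * s)) - (1 + -(e * s) + (e * s) ^ 2 / 2)) := by
    field_simp; ring
  rw [h2, abs_mul, abs_of_pos (by positivity)]
  calc _ ≤ 2 * e⁻¹ ^ 2 * (|e| ^ 3 * |s| ^ 3 * (2 / 9)) := by
        gcongr
        refine h.trans (le_of_eq ?_)
        ring
    _ = 4 / 9 * (|s| ^ 3 * e) := by
        rw [abs_of_pos he0]; field_simp; ring
    _ ≤ |s| ^ 3 * e := by
        have : 0 ≤ |s| ^ 3 * e := by positivity
        linarith

/-- With t = 1/(n+1), the kernels 2t⁻²(e^(-t‖z‖²) - 1 + t‖z‖²) tend to ‖z‖⁴ and, by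
`gaussianRemainder_le`, never exceed it; dominated convergence applies. -/
theorem pairing_norm_pow_four_nonneg {f : E → ℝ} (hf : HasMoment 4 f)
    (hc : IsNeutralCentered f) : 0 ≤ pairing (fun z => ‖z‖ ^ 4) f f := by
  have hm := hf.integrable.aestronglyMeasurable
  have hlim : Filter.Tendsto (fun n : ℕ => pairing (fun z => 2 * ((n : ℝ) + 1) ^ 2
      * (rexp (-(1 / ((n : ℝ) + 1) * ‖z‖ ^ 2)) - 1 + 1 / ((n : ℝ) + 1) * ‖z‖ ^ 2)) f f)
      Filter.atTop (nhds (pairing (fun z => ‖z‖ ^ 4) f f)) := by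
    refine tendsto_integral_of_dominated_convergence
      (fun z : E × E => ‖‖z.1 - z.2‖ ^ 4 * (f z.1 * f z.2)‖) (fun n => ?_)
      (pairingIntegrable_norm_pow hf hf).norm (fun n => Filter.Eventually.of_forall fun z => ?_)
      (Filter.Eventually.of_forall fun z => ?_)
    · exact AEStronglyMeasurable.mul (by fun_prop) (hm.comp_fst.mul hm.comp_snd)
    · rw [norm_mul, norm_mul (‖z.1 - z.2‖ ^ 4)]
      gcongr
      have hn0 : (0 : ℝ) < (n : ℝ) + 1 := by positivity
      have h1 := gaussianRemainder_nonneg (1 / ((n : ℝ) + 1) * ‖z.1 - z.2‖ ^ 2)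
      have h2 := gaussianRemainder_le (s := 1 / ((n : ℝ) + 1) * ‖z.1 - z.2‖ ^ 2) (by positivity)
      rw [norm_of_nonneg (mul_nonneg (by positivity) h1), norm_of_nonneg (by positivity)]
      calc _ ≤ 2 * ((n : ℝ) + 1) ^ 2 * ((1 / ((n : ℝ) + 1) * ‖z.1 - z.2‖ ^ 2) ^ 2 / 2) := by gcongr
        _ = ‖z.1 - z.2‖ ^ 4 := by field_simp
    · have := tendsto_gaussianRemainder_div_sq (‖z.1 - z.2‖ ^ 2)
      rw [← pow_mul] at this
      exact this.mul_const _
  refine ge_of_tendsto' hlim fun n => ?_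
  rw [pairing_const_mul_kernel]
  exact mul_nonneg (by positivity)
    (pairing_gaussianRemainder_nonneg (hf.mono (by norm_num)) hc (by positivity))

theorem gamma_half_mul_pairing_norm_inv [Nontrivial E] {f : E → ℝ}
    (hf : AEStronglyMeasurable f) (hi : PairingIntegrable (fun z => ‖z‖⁻¹) f f) :
    IntegrableOn (fun t : ℝ => t ^ (-(1 / 2) : ℝ)
      * pairing (fun z => rexp (-(t * ‖z‖ ^ 2))) f f) (Set.Ioi 0) ∧
    Gamma (1 / 2) * pairing (fun z => ‖z‖⁻¹) f f = ∫ t in Set.Ioi (0 : ℝ), t ^ (-(1 / 2) : ℝ)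
      * pairing (fun z => rexp (-(t * ‖z‖ ^ 2))) f f := by
  have h := pairing_superposition (k := fun z : E => Gamma (1 / 2) * ‖z‖⁻¹)
    (h := fun t z => t ^ (-(1 / 2) : ℝ) * rexp (-(t * ‖z‖ ^ 2)))
    measurableSet_Ioi (by unfold Function.uncurry; fun_prop)
    (fun t ht z => mul_nonneg (rpow_nonneg (le_of_lt ht) _) (exp_pos _).le)
    (fun z hz => (rpow_neg_half_integral (norm_pos_iff.2 hz)).1)
    (fun z hz => (rpow_neg_half_integral (norm_pos_iff.2 hz)).2.symm) hf hf (hi.const_mul _)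
  simpa only [pairing_const_mul_kernel] using h

theorem pairing_norm_inv_nonneg [Nontrivial E] {f : E → ℝ} (hf : Integrable f)
    (hi : PairingIntegrable (fun z => ‖z‖⁻¹) f f) : 0 ≤ pairing (fun z => ‖z‖⁻¹) f f := by
  have h := (gamma_half_mul_pairing_norm_inv hf.aestronglyMeasurable hi).2
  refine nonneg_of_mul_nonneg_right ?_ (Gamma_pos_of_pos (s := 1 / 2) (by norm_num))
  rw [h]
  exact setIntegral_nonneg measurableSet_Ioi fun t ht =>
    mul_nonneg (rpow_nonneg (le_of_lt ht) _) (pairing_gaussian_nonneg ht hf)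

theorem ae_eq_zero_of_pairing_norm_inv_eq_zero [Nontrivial E] {f : E → ℝ} (hf : Integrable f)
    (hi : PairingIntegrable (fun z => ‖z‖⁻¹) f f) (h0 : pairing (fun z => ‖z‖⁻¹) f f = 0) :
    f =ᵐ[volume] 0 := by
  obtain ⟨h1, h2⟩ := gamma_half_mul_pairing_norm_inv hf.aestronglyMeasurable hi
  rw [h0, mul_zero, eq_comm, setIntegral_eq_zero_iff_of_nonneg_ae _ h1] at h2
  · have h3 : ∃ t ∈ Set.Ioi (0 : ℝ), t ^ (-(1 / 2) : ℝ)
        * pairing (fun z => rexp (-(t * ‖z‖ ^ 2))) f f = 0 := by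
      have : (ae (volume.restrict (Set.Ioi (0 : ℝ)))).NeBot := by
        rw [ae_neBot]
        simp
      exact ((ae_restrict_mem measurableSet_Ioi).and h2).exists
    obtain ⟨t, ht, h4⟩ := h3
    have h5 := (mul_eq_zero.1 h4).resolve_left (rpow_pos_of_pos ht _).ne'
    exact ae_eq_zero_of_fourierSq_eq_zero hf (fourierSq_eq_zero_of_pairing_gaussian ht hf h5)
  · filter_upwards [ae_restrict_mem measurableSet_Ioi] with t ht
    exact mul_nonneg (rpow_nonneg (le_of_lt ht) _) (pairing_gaussian_nonneg ht hf)

end Superposition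

/-! ### Riesz potentials of a ball in cylindrical coordinates -/

section Cylindrical

/-- Cylindrical splitting of three-space into an axis and an orthogonal plane. -/
def cylEquiv : E3 ≃ᵐ ℝ × EuclideanSpace ℝ (Fin 2) :=
  (MeasurableEquiv.toLp 2 (Fin 3 → ℝ)).symm.trans
    ((MeasurableEquiv.piFinSuccAbove (fun _ : Fin 3 => ℝ) 0).trans
      ((MeasurableEquiv.refl ℝ).prodCongr (MeasurableEquiv.toLp 2 (Fin 2 → ℝ))))

theorem measurePreserving_cylEquiv : MeasurePreserving cylEquiv := by
  have h1 := EuclideanSpace.volume_preserving_symm_measurableEquiv_toLp (Fin 3)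
  have h2 := volume_preserving_piFinSuccAbove (fun _ : Fin 3 => ℝ) 0
  have h3 := (MeasurePreserving.id (volume : Measure ℝ)).prod
    (EuclideanSpace.volume_preserving_symm_measurableEquiv_toLp (Fin 2)).symm
  exact h3.comp (h2.comp h1)

theorem cylEquiv_fst (y : E3) : (cylEquiv y).1 = y 0 := rfl

theorem norm_sq_eq_cylEquiv (y : E3) : ‖y‖ ^ 2 = (cylEquiv y).1 ^ 2 + ‖(cylEquiv y).2‖ ^ 2 := by
  rw [EuclideanSpace.norm_sq_eq, EuclideanSpace.norm_sq_eq, Fin.sum_univ_three, Fin.sum_univ_two]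
  simp only [Real.norm_eq_abs, sq_abs]
  rw [add_assoc]
  rfl

theorem norm_single_sub_sq (r : ℝ) (y : E3) : ‖EuclideanSpace.single 0 r - y‖ ^ 2
    = (r - (cylEquiv y).1) ^ 2 + ‖(cylEquiv y).2‖ ^ 2 := by
  have h := norm_sq_eq_cylEquiv y
  rw [norm_sub_sq_real, h, EuclideanSpace.inner_single_left, PiLp.norm_single,
    Real.norm_eq_abs, sq_abs, cylEquiv_fst]
  simp only [conj_trivial]
  ring

theorem integral_cylindrical {F : ℝ → ℝ → ℝ}
    (hF : Integrable fun y : E3 => F (cylEquiv y).1 ‖(cylEquiv y).2‖) :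
    ∫ y : E3, F (cylEquiv y).1 ‖(cylEquiv y).2‖
      = ∫ s, 2 * π * ∫ ρ in Set.Ioi (0 : ℝ), ρ * F s ρ := by
  have h1 := measurePreserving_cylEquiv.integral_comp cylEquiv.measurableEmbedding
    (fun z => F z.1 ‖z.2‖)
  have h2 := (measurePreserving_cylEquiv.integrable_comp_emb cylEquiv.measurableEmbedding
    (g := fun z => F z.1 ‖z.2‖)).1 hF
  rw [h1, Measure.volume_eq_prod, integral_prod _ h2]
  refine integral_congr_ae (Filter.Eventually.of_forall fun s => ?_)
  simp only
  rw [integral_fun_norm_addHaar volume (fun ρ => F s ρ)]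
  simp [Measure.real, EuclideanSpace.volume_ball_fin_two, pi_nonneg]
  ring

/-- The reflection exchanging x and x' preserves norms and volume. -/
theorem integral_comp_norm_eq_of_norm_eq {x x' : E3} (h : ‖x‖ = ‖x'‖) (F : ℝ → ℝ → ℝ) :
    ∫ y, F ‖x - y‖ ‖y‖ = ∫ y, F ‖x' - y‖ ‖y‖ := by
  set R := (ℝ ∙ (x - x'))ᗮ.reflection with hR
  have hx : R x = x' := Submodule.reflection_sub h
  rw [← (R.measurePreserving).integral_comp R.toHomeomorph.measurableEmbedding
    (fun y => F ‖x' - y‖ ‖y‖)]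
  refine integral_congr_ae (Filter.Eventually.of_forall fun y => ?_)
  simp only
  rw [← hx, ← map_sub, R.norm_map, R.norm_map]

/-- Indexing the kernel exponent as N - 2 treats the Coulomb case N = 1 together with the positive
powers. The antiderivative may fail to be differentiable at the endpoint 0, so integrability comes
from nonnegativity of its derivative. -/
theorem integral_mul_rpow_add_sq {N : ℕ} (hN : 1 ≤ N) (d : ℝ) {R : ℝ} (hR : 0 ≤ R) :
    ∫ ρ in (0 : ℝ)..R, ρ * (d ^ 2 + ρ ^ 2) ^ (((N : ℝ) - 2) / 2)
      = ((d ^ 2 + R ^ 2) ^ ((N : ℝ) / 2) - (d ^ 2) ^ ((N : ℝ) / 2)) / N := by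
  have hN0 : (0 : ℝ) < N := by exact_mod_cast hN
  have hcont : Continuous fun ρ : ℝ => (d ^ 2 + ρ ^ 2) ^ ((N : ℝ) / 2) / N :=
    (Continuous.rpow_const (by fun_prop) fun ρ => Or.inr (by positivity)).div_const _
  have hderiv : ∀ ρ ∈ Set.Ioo 0 R, HasDerivAt (fun ρ : ℝ => (d ^ 2 + ρ ^ 2) ^ ((N : ℝ) / 2) / N)
      (ρ * (d ^ 2 + ρ ^ 2) ^ (((N : ℝ) - 2) / 2)) ρ := by
    intro ρ hρ
    have h0 : 0 < d ^ 2 + ρ ^ 2 := add_pos_of_nonneg_of_pos (sq_nonneg d) (pow_pos hρ.1 2)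
    have h1 : HasDerivAt (fun ρ : ℝ => d ^ 2 + ρ ^ 2) (2 * ρ) ρ := by
      simpa using (hasDerivAt_pow 2 ρ).const_add (d ^ 2)
    have h2 := (h1.rpow_const (p := (N : ℝ) / 2) (Or.inl h0.ne')).div_const (N : ℝ)
    refine h2.congr_deriv ?_
    rw [show ((N : ℝ) - 2) / 2 = (N : ℝ) / 2 - 1 by ring]
    field_simp
  have hint := intervalIntegral.integrableOn_deriv_of_nonneg hcont.continuousOn hderiv
    fun ρ hρ => mul_nonneg hρ.1.le (rpow_nonneg (by positivity) _)
  rw [intervalIntegral.integral_eq_sub_of_hasDerivAt_of_le hR hcont.continuousOn hderiv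
    ((intervalIntegrable_iff_integrableOn_Ioc_of_le hR).2 hint)]
  simp only [ne_eq, OfNat.ofNat_ne_zero, not_false_eq_true, zero_pow, add_zero]
  ring

theorem sq_rpow_half (t : ℝ) (N : ℕ) : (t ^ 2) ^ ((N : ℝ) / 2) = |t| ^ N := by
  rw [← sq_abs, ← rpow_natCast, ← rpow_mul (abs_nonneg t), ← rpow_natCast]
  congr 1
  push_cast
  ring

/-- The Riesz potential `∫_{‖y‖ ≤ a} ‖x - y‖ ^ (N - 2) dy` of a ball, at `‖x‖ = r`. -/
def rieszBall (N : ℕ) (a r : ℝ) : ℝ :=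
  2 * π / N * (((r + a) ^ (N + 2) - |r - a| ^ (N + 2)) / ((N + 2) * r)
    - ∫ t in (r - a)..(r + a), |t| ^ N)

/-- On the sphere the squared distance (r - s)² + a² - s² = r² + a² - 2rs is affine in s, so the
first term is the integral of a power of an affine function. -/
theorem integral_axis {N : ℕ} {a r : ℝ} (ha : 0 < a) (hr : 0 < r) :
    ∫ s in (-a)..a, (((r - s) ^ 2 + (a ^ 2 - s ^ 2)) ^ ((N : ℝ) / 2) - |r - s| ^ N)
      = ((r + a) ^ (N + 2) - |r - a| ^ (N + 2)) / ((N + 2) * r)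
        - ∫ t in (r - a)..(r + a), |t| ^ N := by
  have hc1 : Continuous fun s : ℝ => ((r - s) ^ 2 + (a ^ 2 - s ^ 2)) ^ ((N : ℝ) / 2) :=
    Continuous.rpow_const (by fun_prop) fun ρ => Or.inr (by positivity)
  have hc2 : Continuous fun s : ℝ => |r - s| ^ N := by fun_prop
  rw [intervalIntegral.integral_sub (hc1.intervalIntegrable _ _) (hc2.intervalIntegrable _ _)]
  congr 1
  · have h1 := intervalIntegral.integral_comp_sub_mul (a := -a) (b := a)
      (fun t : ℝ => t ^ ((N : ℝ) / 2)) (c := 2 * r) (by positivity) (r ^ 2 + a ^ 2)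
    have h2 : ∀ s : ℝ, (r - s) ^ 2 + (a ^ 2 - s ^ 2) = r ^ 2 + a ^ 2 - 2 * r * s := fun s => by ring
    simp_rw [h2]
    have hNN : (-1 : ℝ) < (N : ℝ) / 2 := by
      have : (0 : ℝ) ≤ (N : ℝ) / 2 := by positivity
      linarith
    rw [h1, integral_rpow (Or.inl hNN),
      show r ^ 2 + a ^ 2 - 2 * r * a = (r - a) ^ 2 by ring,
      show r ^ 2 + a ^ 2 - 2 * r * -a = (r + a) ^ 2 by ring,
      show (N : ℝ) / 2 + 1 = ((N + 2 : ℕ) : ℝ) / 2 by push_cast; ring,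
      sq_rpow_half, sq_rpow_half, abs_of_pos (add_pos hr ha), smul_eq_mul]
    push_cast
    have : (N : ℝ) + 2 ≠ 0 := by positivity
    field_simp
  · rw [intervalIntegral.integral_comp_sub_left (fun t : ℝ => |t| ^ N) r, sub_neg_eq_add]

/-- Move x to the axis by symmetry. The slice of the ball at height s is a disc of radius √(a² -
s²), over which the integral is elementary. -/
theorem setIntegral_closedBall_rpow {N : ℕ} (hN : 1 ≤ N) {a : ℝ} (ha : 0 < a) {x : E3} (hx : x ≠ 0)
    (hint : ∀ x : E3, IntegrableOn (fun y => ‖x - y‖ ^ ((N : ℝ) - 2)) (Metric.closedBall 0 a)) :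
    ∫ y in Metric.closedBall (0 : E3) a, ‖x - y‖ ^ ((N : ℝ) - 2) = rieszBall N a ‖x‖ := by
  set r := ‖x‖ with hr
  have hr0 : 0 < r := norm_pos_iff.2 hx
  set x' : E3 := EuclideanSpace.single 0 r with hx'
  have hnorm : ‖x‖ = ‖x'‖ := by
    rw [hx', PiLp.norm_single, Real.norm_of_nonneg hr0.le]
  have hind : ∀ x : E3, (Metric.closedBall (0 : E3) a).indicator
      (fun y => ‖x - y‖ ^ ((N : ℝ) - 2))
      = fun y => if ‖y‖ ≤ a then ‖x - y‖ ^ ((N : ℝ) - 2) else 0 := by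
    intro x
    funext y
    simp [Set.indicator]
  set F : ℝ → ℝ → ℝ := fun s ρ =>
    if s ^ 2 + ρ ^ 2 ≤ a ^ 2 then ((r - s) ^ 2 + ρ ^ 2) ^ (((N : ℝ) - 2) / 2) else 0 with hF
  have hFy : ∀ y : E3, (if ‖y‖ ≤ a then ‖x' - y‖ ^ ((N : ℝ) - 2) else 0)
      = F (cylEquiv y).1 ‖(cylEquiv y).2‖ := by
    intro y
    simp only [hF, ← norm_sq_eq_cylEquiv, ← norm_single_sub_sq, sq_le_sq₀ (norm_nonneg y) ha.le,
      ← hx']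
    rw [← rpow_natCast ‖x' - y‖ 2, ← rpow_mul (norm_nonneg _)]
    congr 2
    push_cast
    ring
  have hFint : Integrable fun y : E3 => F (cylEquiv y).1 ‖(cylEquiv y).2‖ := by
    simp_rw [← hFy]
    rw [← hind]
    exact (hint x').integrable_indicator measurableSet_closedBall
  have hinner : ∀ s : ℝ, ∫ ρ in Set.Ioi (0 : ℝ), ρ * F s ρ = (Set.Icc (-a) a).indicator
      (fun s => (((r - s) ^ 2 + (a ^ 2 - s ^ 2)) ^ ((N : ℝ) / 2) - |r - s| ^ N) / N) s := by
    intro s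
    by_cases hs : s ∈ Set.Icc (-a) a
    · rw [Set.indicator_of_mem hs]
      have hs2 : 0 ≤ a ^ 2 - s ^ 2 := by nlinarith [hs.1, hs.2]
      have h1 : Set.EqOn (fun ρ => ρ * F s ρ) ((Set.Ioc 0 √(a ^ 2 - s ^ 2)).indicator
          fun ρ => ρ * ((r - s) ^ 2 + ρ ^ 2) ^ (((N : ℝ) - 2) / 2)) (Set.Ioi 0) := by
        intro ρ hρ
        have hρ0 : (0 : ℝ) < ρ := hρ
        simp only [hF, Set.indicator, Set.mem_Ioc, hρ0, true_and, Real.le_sqrt hρ0.le hs2]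
        by_cases hc : ρ ^ 2 ≤ a ^ 2 - s ^ 2
        · rw [if_pos hc, if_pos (by linarith)]
        · rw [if_neg hc, if_neg (by linarith), mul_zero]
      rw [setIntegral_congr_fun measurableSet_Ioi h1, setIntegral_indicator measurableSet_Ioc,
        Set.inter_eq_self_of_subset_right (fun ρ hρ => hρ.1),
        ← intervalIntegral.integral_of_le (sqrt_nonneg _),
        integral_mul_rpow_add_sq hN _ (sqrt_nonneg _), sq_sqrt hs2, sq_rpow_half]
    · rw [Set.indicator_of_notMem hs]
      have h1 : ∀ ρ, ρ * F s ρ = 0 := by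
        intro ρ
        have : ¬ (s ^ 2 + ρ ^ 2 ≤ a ^ 2) := by
          intro h
          exact hs (abs_le.1 (abs_le_of_sq_le_sq (by nlinarith [sq_nonneg ρ]) ha.le))
        simp only [hF, if_neg this, mul_zero]
      simp [h1]
  calc ∫ y in Metric.closedBall (0 : E3) a, ‖x - y‖ ^ ((N : ℝ) - 2)
      = ∫ y : E3, if ‖y‖ ≤ a then ‖x - y‖ ^ ((N : ℝ) - 2) else 0 := by
        rw [← integral_indicator measurableSet_closedBall, hind]
    _ = ∫ y : E3, if ‖y‖ ≤ a then ‖x' - y‖ ^ ((N : ℝ) - 2) else 0 :=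
        integral_comp_norm_eq_of_norm_eq hnorm fun u v => if v ≤ a then u ^ ((N : ℝ) - 2) else 0
    _ = ∫ y : E3, F (cylEquiv y).1 ‖(cylEquiv y).2‖ := by simp_rw [hFy]
    _ = rieszBall N a r := by
        rw [integral_cylindrical hFint]
        simp_rw [hinner]
        rw [integral_const_mul, integral_indicator measurableSet_Icc,
          integral_Icc_eq_integral_Ioc, ← intervalIntegral.integral_of_le (by linarith),
          intervalIntegral.integral_div, integral_axis ha hr0, rieszBall]
        ring

theorem rieszBall_of_le (N : ℕ) {a r : ℝ} (h : a ≤ r) (ha : 0 < a) : rieszBall N a r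
    = 2 * π / N * (((r + a) ^ (N + 2) - (r - a) ^ (N + 2)) / ((N + 2) * r)
      - ((r + a) ^ (N + 1) - (r - a) ^ (N + 1)) / (N + 1)) := by
  have h1 : ∫ t in (r - a)..(r + a), |t| ^ N = ∫ t in (r - a)..(r + a), t ^ N := by
    refine intervalIntegral.integral_congr fun t ht => ?_
    rw [Set.uIcc_of_le (by linarith)] at ht
    rw [abs_of_nonneg (by linarith [ht.1])]
  rw [rieszBall, h1, integral_pow, abs_of_nonneg (by linarith)]

theorem rieszBall_of_ge (N : ℕ) {a r : ℝ} (h : r ≤ a) (hr : 0 < r) : rieszBall N a r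
    = 2 * π / N * (((a + r) ^ (N + 2) - (a - r) ^ (N + 2)) / ((N + 2) * r)
      - ((a + r) ^ (N + 1) + (a - r) ^ (N + 1)) / (N + 1)) := by
  have hpos : ∀ c : ℝ, 0 ≤ c → ∫ t in (0 : ℝ)..c, |t| ^ N = c ^ (N + 1) / (N + 1) := by
    intro c hc
    have h1 : ∫ t in (0 : ℝ)..c, |t| ^ N = ∫ t in (0 : ℝ)..c, t ^ N := by
      refine intervalIntegral.integral_congr fun t ht => ?_
      rw [Set.uIcc_of_le hc] at ht
      rw [abs_of_nonneg ht.1]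
    rw [h1, integral_pow]
    simp
  have hneg : ∫ t in (r - a)..0, |t| ^ N = ∫ t in (0 : ℝ)..(a - r), |t| ^ N := by
    have := intervalIntegral.integral_comp_neg (a := r - a) (b := 0) (fun t : ℝ => |t| ^ N)
    simpa using this
  have hc : Continuous fun t : ℝ => |t| ^ N := by fun_prop
  rw [rieszBall, ← intervalIntegral.integral_add_adjacent_intervals (b := 0)
    (hc.intervalIntegrable _ _) (hc.intervalIntegrable _ _), hneg, hpos _ (by linarith),
    hpos _ (by linarith), abs_of_nonpos (by linarith), neg_sub, add_comm r a]
  ring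

end Cylindrical

/-! ### Euler–Lagrange conditions, minimality and perturbations -/

section Minimizers

theorem integrableOn_closedBall_norm_pow (q : ℕ) (a : ℝ) (x : E3) :
    IntegrableOn (fun y => ‖x - y‖ ^ q) (Metric.closedBall 0 a) :=
  (by fun_prop : Continuous fun y : E3 => ‖x - y‖ ^ q).continuousOn.integrableOn_compact
    (isCompact_closedBall 0 a)

theorem integrableOn_closedBall_norm_inv (a : ℝ) (x : E3) :
    IntegrableOn (fun y => ‖x - y‖⁻¹) (Metric.closedBall 0 a) := by
  have h1 := (integrable_indicator_ball_norm_inv.comp_sub_left x).integrableOn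
    (s := Metric.closedBall (0 : E3) a)
  have h2 : IntegrableOn (fun _ : E3 => (1 : ℝ)) (Metric.closedBall 0 a) :=
    integrableOn_const measure_closedBall_lt_top.ne
  refine (h1.add h2).mono' (by fun_prop) (Filter.Eventually.of_forall fun y => ?_)
  have h0 := inv_nonneg.2 (norm_nonneg (x - y))
  rw [norm_of_nonneg h0]
  simp only [Pi.add_apply]
  split_ifs with h
  · linarith
  · rw [zero_add]
    exact inv_le_one_of_one_le₀ (not_le.1 h).le

theorem setIntegral_closedBall_norm_pow (q : ℕ) {a : ℝ} (ha : 0 < a) {x : E3} (hx : x ≠ 0) :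
    ∫ y in Metric.closedBall (0 : E3) a, ‖x - y‖ ^ q = rieszBall (q + 2) a ‖x‖ := by
  have h1 : ((q + 2 : ℕ) : ℝ) - 2 = q := by push_cast; ring
  have h := setIntegral_closedBall_rpow (N := q + 2) (by omega) ha hx
  simp only [h1, rpow_natCast] at h
  exact h fun x => integrableOn_closedBall_norm_pow q a x

theorem setIntegral_closedBall_norm_inv {a : ℝ} (ha : 0 < a) {x : E3} (hx : x ≠ 0) :
    ∫ y in Metric.closedBall (0 : E3) a, ‖x - y‖⁻¹ = rieszBall 1 a ‖x‖ := by
  have h1 : ((1 : ℕ) : ℝ) - 2 = -1 := by norm_num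
  have h := setIntegral_closedBall_rpow (N := 1) le_rfl ha hx
  simp only [h1, rpow_neg_one] at h
  exact h fun x => integrableOn_closedBall_norm_inv a x

/-- The kernel `‖z‖ ^ q / q + 1 / ‖z‖` on three-space. -/
def coulombKernel (q : ℕ) (z : E3) : ℝ := (q : ℝ)⁻¹ * ‖z‖ ^ q + ‖z‖⁻¹

theorem powerKernel_eq_coulombKernel (q : ℕ) (z : E3) :
    powerKernel 3 (-1) q z = coulombKernel q z := by
  rw [powerKernel, coulombKernel, rpow_natCast, rpow_neg_one]
  ring

theorem coulombKernel_neg (q : ℕ) (z : E3) : coulombKernel q (-z) = coulombKernel q z := by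
  simp [coulombKernel]

theorem coulombKernel_nonneg (q : ℕ) (z : E3) : 0 ≤ coulombKernel q z := by
  unfold coulombKernel; positivity

theorem pairingIntegrable_coulombKernel {q : ℕ} {f g : E3 → ℝ} (hf : HasMoment q f)
    (hg : HasMoment q g) : PairingIntegrable (coulombKernel q) f g :=
  ((pairingIntegrable_norm_pow hf hg).const_mul _).add
    (pairingIntegrable_norm_inv (hf.mono (Nat.zero_le q)) (hg.mono (Nat.zero_le q)))

theorem pairing_coulombKernel {q : ℕ} {f : E3 → ℝ} (hf : HasMoment q f) :
    pairing (coulombKernel q) f f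
      = (q : ℝ)⁻¹ * pairing (fun z => ‖z‖ ^ q) f f + pairing (fun z => ‖z‖⁻¹) f f := by
  rw [← pairing_const_mul_kernel]
  exact pairing_add_kernel ((pairingIntegrable_norm_pow hf hf).const_mul _)
    (pairingIntegrable_norm_inv (hf.mono (Nat.zero_le q)) (hf.mono (Nat.zero_le q)))

/-- Conditional positivity of the power kernel `‖z‖ ^ q` on three-space. -/
def IsConditionallyPositive (q : ℕ) : Prop :=
  ∀ f : E3 → ℝ, HasMoment q f → IsNeutralCentered f → 0 ≤ pairing (fun z => ‖z‖ ^ q) f f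

theorem pairing_coulombKernel_nonneg {q : ℕ} (hq : IsConditionallyPositive q) {f : E3 → ℝ}
    (hf : HasMoment q f) (hc : IsNeutralCentered f) : 0 ≤ pairing (coulombKernel q) f f := by
  rw [pairing_coulombKernel hf]
  have h0 := hf.mono (Nat.zero_le q)
  exact add_nonneg (mul_nonneg (by positivity) (hq f hf hc))
    (pairing_norm_inv_nonneg hf.integrable (pairingIntegrable_norm_inv h0 h0))

theorem ae_eq_zero_of_pairing_coulombKernel {q : ℕ} (hq : IsConditionallyPositive q) {f : E3 → ℝ}
    (hf : HasMoment q f) (hc : IsNeutralCentered f) (h : pairing (coulombKernel q) f f ≤ 0) :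
    f =ᵐ[volume] 0 := by
  rw [pairing_coulombKernel hf] at h
  have h0 := hf.mono (Nat.zero_le q)
  have hi := pairingIntegrable_norm_inv h0 h0
  have h1 : 0 ≤ (q : ℝ)⁻¹ * pairing (fun z => ‖z‖ ^ q) f f :=
    mul_nonneg (by positivity) (hq f hf hc)
  have h2 := pairing_norm_inv_nonneg hf.integrable hi
  exact ae_eq_zero_of_pairing_norm_inv_eq_zero hf.integrable hi (by linarith)

theorem IsAdmissible.ae_abs_le {q : ℕ} {m M : ℝ} (hM : 0 < M) {u : E3 → ℝ}
    (hu : IsAdmissible 3 q m M u) : ∀ᵐ x, |u x| ≤ M := by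
  have h := hu.bounded
  rw [eLpNorm_exponent_top] at h
  filter_upwards [ae_le_eLpNormEssSup (f := u) (μ := volume)] with x hx
  have h1 := hx.trans h
  rw [← ofReal_norm, ENNReal.ofReal_le_ofReal_iff hM.le] at h1
  exact h1

theorem IsAdmissible.hasMoment {q : ℕ} {m M : ℝ} (hM : 0 < M) {u : E3 → ℝ}
    (hu : IsAdmissible 3 q m M u) : HasMoment q u := by
  refine ⟨hu.integrable, ?_, M, hu.ae_abs_le hM⟩
  refine hu.moment.mono' ((by fun_prop : AEStronglyMeasurable (fun x : E3 => ‖x‖ ^ q)).mul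
    hu.integrable.aestronglyMeasurable) (Filter.Eventually.of_forall fun x => ?_)
  rw [rpow_natCast, norm_mul, norm_pow, norm_norm, Real.norm_eq_abs]
  have := abs_nonneg (u x)
  nlinarith

theorem HasMoment.isAdmissible {q : ℕ} {m M : ℝ} {u : E3 → ℝ} (hu : HasMoment q u)
    (h0 : ∀ᵐ x, 0 ≤ u x) (hM : ∀ᵐ x, u x ≤ M) (hm : ∫ x, u x = m) : IsAdmissible 3 q m M u := by
  refine ⟨hu.integrable, ?_, h0, ?_, hm⟩
  · refine (hu.moment.norm.add hu.integrable.norm).congr (Filter.Eventually.of_forall fun x => ?_)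
    simp only [Pi.add_apply, norm_mul, norm_pow, norm_norm, rpow_natCast, ← Real.norm_eq_abs]
    ring
  · rw [eLpNorm_exponent_top]
    refine eLpNormEssSup_le_of_ae_bound ?_
    filter_upwards [h0, hM] with x hx hx'
    rwa [norm_of_nonneg hx]

/-- Admissibility makes the energy finite, so it can be expanded as a real quadratic form. -/
theorem interactionEnergy_eq {q : ℕ} {m M : ℝ} (hM : 0 < M) {u : E3 → ℝ}
    (hu : IsAdmissible 3 q m M u) :
    interactionEnergy 3 (-1) q u = ENNReal.ofReal (pairing (coulombKernel q) u u) := by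
  have hi := pairingIntegrable_coulombKernel (hu.hasMoment hM) (hu.hasMoment hM)
  unfold interactionEnergy pairing
  rw [ofReal_integral_eq_lintegral_ofReal hi]
  · simp only [powerKernel_eq_coulombKernel, mul_assoc]
  · have h1 : ∀ᵐ z : E3 × E3, 0 ≤ u z.1 := Measure.quasiMeasurePreserving_fst.ae hu.nonneg
    have h2 : ∀ᵐ z : E3 × E3, 0 ≤ u z.2 := Measure.quasiMeasurePreserving_snd.ae hu.nonneg
    filter_upwards [h1, h2] with z hz1 hz2
    exact mul_nonneg (coulombKernel_nonneg q _) (mul_nonneg hz1 hz2)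

theorem pairing_coulombKernel_self_nonneg {q : ℕ} {m M : ℝ} {u : E3 → ℝ}
    (hu : IsAdmissible 3 q m M u) : 0 ≤ pairing (coulombKernel q) u u := by
  refine integral_nonneg_of_ae ?_
  have h1 : ∀ᵐ z : E3 × E3, 0 ≤ u z.1 := Measure.quasiMeasurePreserving_fst.ae hu.nonneg
  have h2 : ∀ᵐ z : E3 × E3, 0 ≤ u z.2 := Measure.quasiMeasurePreserving_snd.ae hu.nonneg
  filter_upwards [h1, h2] with z hz1 hz2
  exact mul_nonneg (coulombKernel_nonneg q _) (mul_nonneg hz1 hz2)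

theorem interactionEnergy_le_iff {q : ℕ} {m M : ℝ} (hM : 0 < M) {u v : E3 → ℝ}
    (hu : IsAdmissible 3 q m M u) (hv : IsAdmissible 3 q m M v) :
    interactionEnergy 3 (-1) q u ≤ interactionEnergy 3 (-1) q v ↔
      pairing (coulombKernel q) u u ≤ pairing (coulombKernel q) v v := by
  rw [interactionEnergy_eq hM hu, interactionEnergy_eq hM hv,
    ENNReal.ofReal_le_ofReal_iff (pairing_coulombKernel_self_nonneg hv)]

theorem interactionEnergy_comp_add_right (p q : ℝ) (u : E3 → ℝ) (c : E3) :
    interactionEnergy 3 p q (fun x => u (x + c)) = interactionEnergy 3 p q u := by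
  unfold interactionEnergy
  rw [Measure.volume_eq_prod,
    ← lintegral_add_right_eq_self (μ := (volume : Measure E3).prod volume)
      (fun z => ENNReal.ofReal (powerKernel 3 p q (z.1 - z.2) * u z.1 * u z.2)) (c, c)]
  simp

theorem IsAdmissible.comp_add_right {q : ℕ} {m M : ℝ} (hM : 0 < M) {u : E3 → ℝ}
    (hu : IsAdmissible 3 q m M u) (c : E3) : IsAdmissible 3 q m M fun x => u (x + c) := by
  have hc := (measurePreserving_add_right (volume : Measure E3) c).quasiMeasurePreserving
  refine ((hu.hasMoment hM).comp_add_right c).isAdmissible (hc.ae hu.nonneg)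
    ((hc.ae (hu.ae_abs_le hM)).mono fun x hx => (le_abs_self _).trans hx) ?_
  rw [integral_add_right_eq_self u c, hu.mass]

theorem measureReal_closedBall_three {a : ℝ} (ha : 0 ≤ a) :
    (volume : Measure E3).real (Metric.closedBall 0 a) = 4 * π / 3 * a ^ 3 := by
  rw [Measure.real, EuclideanSpace.volume_closedBall_fin_three, ENNReal.toReal_mul,
    ENNReal.toReal_pow, ENNReal.toReal_ofReal ha, ENNReal.toReal_ofReal (by positivity)]
  ring

theorem ballDensity_apply (M a : ℝ) (x : E3) :
    ballDensity 3 M a x = if ‖x‖ ≤ a then M else 0 := by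
  simp [ballDensity, Set.indicator]

theorem hasMoment_indicator_const (q : ℕ) {s : Set E3} (hs : MeasurableSet s) {R : ℝ}
    (hb : s ⊆ Metric.closedBall 0 R) (M : ℝ) : HasMoment q (s.indicator fun _ => M) := by
  have h0 : Integrable (s.indicator fun _ => M) :=
    (integrableOn_const ((measure_mono hb).trans_lt measure_closedBall_lt_top).ne).integrable_indicator
      hs
  refine ⟨h0, ?_, |M|, Filter.Eventually.of_forall fun x => ?_⟩
  · refine (h0.norm.const_mul (R ^ q)).mono'
      ((by fun_prop : AEStronglyMeasurable (fun x : E3 => ‖x‖ ^ q)).mul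
        h0.aestronglyMeasurable) (Filter.Eventually.of_forall fun x => ?_)
    rw [norm_mul, norm_pow, norm_norm]
    by_cases hx : x ∈ s
    · have := mem_closedBall_zero_iff.1 (hb hx)
      gcongr
    · simp [Set.indicator_of_notMem hx]
  · by_cases hx : x ∈ s
    · rw [Set.indicator_of_mem hx]
    · rw [Set.indicator_of_notMem hx, abs_zero]
      exact abs_nonneg M

theorem hasMoment_ballDensity (q : ℕ) (M a : ℝ) : HasMoment q (ballDensity 3 M a) :=
  hasMoment_indicator_const q measurableSet_closedBall subset_rfl M

theorem isAdmissible_ballDensity (q : ℕ) {m M a : ℝ} (hM : 0 < M) (ha : 0 < a)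
    (hm : m = 4 * π / 3 * M * a ^ 3) : IsAdmissible 3 q m M (ballDensity 3 M a) := by
  refine (hasMoment_ballDensity q M a).isAdmissible (Filter.Eventually.of_forall fun x => ?_)
    (Filter.Eventually.of_forall fun x => ?_) ?_
  · rw [ballDensity_apply]; split_ifs <;> simp [hM.le]
  · rw [ballDensity_apply]; split_ifs <;> simp [hM.le]
  · rw [ballDensity, integral_indicator measurableSet_closedBall, setIntegral_const,
      measureReal_closedBall_three ha.le, hm, smul_eq_mul]
    ring

/-- The radial profile of the potential generated by the indicator function of a ball. -/
def ballProfile (q : ℕ) (a r : ℝ) : ℝ := (q : ℝ)⁻¹ * rieszBall (q + 2) a r + rieszBall 1 a r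

theorem integral_coulombKernel_mul_ballDensity (q : ℕ) (M : ℝ) {a : ℝ} (ha : 0 < a) {x : E3}
    (hx : x ≠ 0) :
    ∫ y, coulombKernel q (x - y) * ballDensity 3 M a y = M * ballProfile q a ‖x‖ := by
  have h1 : ∀ y, coulombKernel q (x - y) * ballDensity 3 M a y
      = (Metric.closedBall (0 : E3) a).indicator
        (fun y => M * ((q : ℝ)⁻¹ * ‖x - y‖ ^ q + ‖x - y‖⁻¹)) y := by
    intro y
    by_cases hy : y ∈ Metric.closedBall (0 : E3) a
    · rw [ballDensity, Set.indicator_of_mem hy, Set.indicator_of_mem hy, coulombKernel]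
      ring
    · rw [ballDensity, Set.indicator_of_notMem hy, Set.indicator_of_notMem hy, mul_zero]
  simp_rw [h1]
  rw [integral_indicator measurableSet_closedBall, integral_const_mul,
    integral_add ((integrableOn_closedBall_norm_pow q a x).const_mul _)
      (integrableOn_closedBall_norm_inv a x), integral_const_mul,
    setIntegral_closedBall_norm_pow q ha hx, setIntegral_closedBall_norm_inv ha hx, ballProfile]

theorem pairing_ballDensity_right {q : ℕ} {M a : ℝ} (ha : 0 < a) {f : E3 → ℝ}
    (hf : HasMoment q f) :
    Integrable (fun x => M * ballProfile q a ‖x‖ * f x) ∧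
    pairing (coulombKernel q) f (ballDensity 3 M a) = ∫ x, M * ballProfile q a ‖x‖ * f x := by
  have hi := pairingIntegrable_coulombKernel hf (hasMoment_ballDensity q M a)
  -- The closed form of the potential divides by ‖x‖; the origin is a null set.
  have h0 : ∀ᵐ x : E3, x ≠ 0 := by simp [ae_iff]
  have h1 : (fun x => (∫ y, coulombKernel q (x - y) * ballDensity 3 M a y) * f x)
      =ᵐ[volume] fun x => M * ballProfile q a ‖x‖ * f x := by
    filter_upwards [h0] with x hx
    rw [integral_coulombKernel_mul_ballDensity q M ha hx]
  exact ⟨(integrable_potential_mul hi).congr h1,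
    (pairing_eq_integral_potential hi).trans (integral_congr_ae h1)⟩

theorem pairing_coulombKernel_add_const_mul {q : ℕ} {f g : E3 → ℝ} (hf : HasMoment q f)
    (hg : HasMoment q g) (s : ℝ) :
    pairing (coulombKernel q) (fun x => f x + s * g x) (fun x => f x + s * g x)
      = pairing (coulombKernel q) f f + 2 * s * pairing (coulombKernel q) g f
        + s ^ 2 * pairing (coulombKernel q) g g :=
  pairing_add_const_mul_self (coulombKernel_neg q) (pairingIntegrable_coulombKernel hf hf)
    (pairingIntegrable_coulombKernel hf hg) (pairingIntegrable_coulombKernel hg hf)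
    (pairingIntegrable_coulombKernel hg hg) s

/-- The Euler–Lagrange inequalities for the potential of the ball of radius `a`. -/
structure EulerLagrangeBall (q : ℕ) (a : ℝ) : Prop where
  inside : ∀ r, 0 < r → r ≤ a → ballProfile q a r ≤ ballProfile q a a
  outside : ∀ r, a ≤ r → ballProfile q a a ≤ ballProfile q a r

theorem integral_ballDensity_smul_self (M a : ℝ) : ∫ x, ballDensity 3 M a x • x = 0 := by
  have h := integral_neg_eq_self (fun x : E3 => ballDensity 3 M a x • x) volume
  have h1 : ∀ x : E3, ballDensity 3 M a (-x) • (-x) = -(ballDensity 3 M a x • x) := by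
    intro x
    rw [ballDensity_apply, ballDensity_apply, norm_neg, smul_neg]
  simp_rw [h1] at h
  rw [integral_neg] at h
  rw [neg_eq_iff_add_eq_zero, ← two_smul ℝ] at h
  exact (smul_eq_zero.1 h).resolve_left two_ne_zero

/-- The bathtub step: v - u is nonpositive in the ball, nonnegative outside and has zero mass, so
its pairing with the potential of u is at least the boundary value times 0. -/
theorem EulerLagrangeBall.pairing_add_le {q : ℕ} {m M a : ℝ} (hEL : EulerLagrangeBall q a)
    (hM : 0 < M) (ha : 0 < a) (hm : m = 4 * π / 3 * M * a ^ 3) {v : E3 → ℝ}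
    (hv : IsAdmissible 3 q m M v) :
    pairing (coulombKernel q) (ballDensity 3 M a) (ballDensity 3 M a)
      + pairing (coulombKernel q) (fun x => v x - ballDensity 3 M a x)
        (fun x => v x - ballDensity 3 M a x) ≤ pairing (coulombKernel q) v v := by
  set u := ballDensity 3 M a with hu
  have hum := hasMoment_ballDensity q M a
  have hvm := hv.hasMoment hM
  have hs := hvm.sub hum
  set σ : E3 → ℝ := fun x => v x - u x with hσ
  have h1 := pairing_coulombKernel_add_const_mul hum hs 1
  have h2 : (fun x => u x + 1 * σ x) = v := by funext x; simp [hσ]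
  obtain ⟨h3, h4⟩ := pairing_ballDensity_right (M := M) ha hs
  have h5 : ∫ x, M * ballProfile q a a * σ x = 0 := by
    rw [integral_const_mul, hσ, integral_sub hvm.integrable hum.integrable, hv.mass,
      (isAdmissible_ballDensity q hM ha hm).mass, sub_self, mul_zero]
  have h6 : 0 ≤ pairing (coulombKernel q) σ u := by
    rw [h4, ← h5]
    refine integral_mono_ae (hs.integrable.const_mul _) h3 ?_
    have h0 : ∀ᵐ x : E3, x ≠ 0 := by simp [ae_iff]
    filter_upwards [h0, hv.nonneg, hv.ae_abs_le hM] with x hx hx0 hxM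
    simp only [hσ, hu, ballDensity_apply]
    have hxM' := (le_abs_self _).trans hxM
    split_ifs with hxa
    · have := hEL.inside ‖x‖ (norm_pos_iff.2 hx) hxa
      exact mul_le_mul_of_nonpos_right (mul_le_mul_of_nonneg_left this hM.le) (by linarith)
    · have := hEL.outside ‖x‖ (not_le.1 hxa).le
      exact mul_le_mul_of_nonneg_right (mul_le_mul_of_nonneg_left this hM.le) (by linarith)
  rw [h2] at h1
  rw [h1]
  linarith

theorem isNeutralCentered_sub_ballDensity {q : ℕ} (hq : 1 ≤ q) {m M a : ℝ} (hM : 0 < M)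
    (ha : 0 < a) (hm : m = 4 * π / 3 * M * a ^ 3) {v : E3 → ℝ} (hv : IsAdmissible 3 q m M v)
    (hc : ∫ x, v x • x = 0) : IsNeutralCentered fun x => v x - ballDensity 3 M a x := by
  have hum := hasMoment_ballDensity q M a
  have hvm := hv.hasMoment hM
  refine ⟨?_, ?_⟩
  · rw [integral_sub hvm.integrable hum.integrable, hv.mass,
      (isAdmissible_ballDensity q hM ha hm).mass, sub_self]
  · simp_rw [sub_smul]
    rw [integral_sub (hvm.integrable_smul_self hq) (hum.integrable_smul_self hq), hc,
      integral_ballDensity_smul_self, sub_zero]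

theorem exists_centered_translate {q : ℕ} (hq : 1 ≤ q) {m M : ℝ} (hM : 0 < M) (hm : 0 < m)
    {v : E3 → ℝ} (hv : IsAdmissible 3 q m M v) : ∃ c : E3, ∫ x, v (x + c) • x = 0 := by
  have hvm := hv.hasMoment hM
  refine ⟨m⁻¹ • ∫ x, v x • x, ?_⟩
  set c : E3 := m⁻¹ • ∫ x, v x • x with hc
  rw [← integral_sub_right_eq_self _ c]
  simp only [sub_add_cancel, smul_sub]
  rw [integral_sub (hvm.integrable_smul_self hq) (hvm.integrable.smul_const c), integral_smul_const,
    hv.mass, hc, smul_inv_smul₀ hm.ne', sub_self]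

/-- Translating a competitor to centre of mass 0 keeps its energy and makes its difference from the
ball neutral and centred, where the quadratic term is positive definite. -/
theorem EulerLagrangeBall.isMinimizer_and_unique {q : ℕ} {m M a : ℝ} (hEL : EulerLagrangeBall q a)
    (hq : 1 ≤ q) (hpos : IsConditionallyPositive q) (hM : 0 < M) (ha : 0 < a)
    (hm : m = 4 * π / 3 * M * a ^ 3) :
    IsMinimizer 3 (-1) q m M (ballDensity 3 M a) ∧
      UniqueUpToTranslation 3 (-1) q m M (ballDensity 3 M a) := by
  have hm0 : 0 < m := by rw [hm]; positivity
  have hu := isAdmissible_ballDensity q hM ha hm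
  refine ⟨⟨hu, fun v hv => ?_⟩, fun v hv => ?_⟩
  · obtain ⟨c, hc⟩ := exists_centered_translate hq hM hm0 hv
    have hv' := hv.comp_add_right hM c
    rw [← interactionEnergy_comp_add_right _ _ v c, interactionEnergy_le_iff hM hu hv']
    have h1 := hEL.pairing_add_le hM ha hm hv'
    have h2 := pairing_coulombKernel_nonneg hpos
      ((hv'.hasMoment hM).sub (hasMoment_ballDensity q M a))
      (isNeutralCentered_sub_ballDensity hq hM ha hm hv' hc)
    linarith
  · obtain ⟨c, hc⟩ := exists_centered_translate hq hM hm0 hv.admissible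
    have hv' := hv.admissible.comp_add_right hM c
    have h0 := hv.le_energy _ hu
    rw [← interactionEnergy_comp_add_right _ _ v c, interactionEnergy_le_iff hM hv' hu] at h0
    have h1 := hEL.pairing_add_le hM ha hm hv'
    have h2 := ae_eq_zero_of_pairing_coulombKernel hpos
      ((hv'.hasMoment hM).sub (hasMoment_ballDensity q M a))
      (isNeutralCentered_sub_ballDensity hq hM ha hm hv' hc) (by linarith)
    refine ⟨c, ?_⟩
    have h3 := (measurePreserving_sub_right (volume : Measure E3) c).quasiMeasurePreserving.ae h2
    filter_upwards [h3] with x hx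
    simpa [sub_eq_zero] using hx

theorem not_isMinimizer_of_perturbation {q : ℕ} {m M a : ℝ} (hM : 0 < M) (ha : 0 < a)
    (hm : m = 4 * π / 3 * M * a ^ 3) {σ : E3 → ℝ} (hσ : HasMoment q σ) (hmass : ∫ x, σ x = 0)
    {s₀ : ℝ} (hs₀ : 0 < s₀)
    (hbd : ∀ s, 0 < s → s ≤ s₀ → ∀ x, 0 ≤ ballDensity 3 M a x + s * σ x ∧
      ballDensity 3 M a x + s * σ x ≤ M)
    (hneg : pairing (coulombKernel q) σ (ballDensity 3 M a) < 0) :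
    ¬ IsMinimizer 3 (-1) q m M (ballDensity 3 M a) := by
  intro hmin
  have hum := hasMoment_ballDensity q M a
  have hu := isAdmissible_ballDensity q hM ha hm
  set P := pairing (coulombKernel q) σ (ballDensity 3 M a) with hP
  set Q := pairing (coulombKernel q) σ σ with hQ
  have hQ0 : 0 < |Q| + 1 := by positivity
  -- This size gives sQ ≤ -P, so 2sP + s²Q ≤ sP < 0.
  set s := min s₀ (-P / (|Q| + 1)) with hs
  have hs0 : 0 < s := lt_min hs₀ (div_pos (neg_pos.2 hneg) hQ0)
  have hv : IsAdmissible 3 q m M fun x => ballDensity 3 M a x + s * σ x := by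
    refine (hum.add_const_mul hσ s).isAdmissible
      (Filter.Eventually.of_forall fun x => (hbd s hs0 (min_le_left _ _) x).1)
      (Filter.Eventually.of_forall fun x => (hbd s hs0 (min_le_left _ _) x).2) ?_
    rw [integral_add hum.integrable (hσ.integrable.const_mul s), integral_const_mul, hmass,
      hu.mass, mul_zero, add_zero]
  have h1 := (interactionEnergy_le_iff hM hu hv).1 (hmin.le_energy _ hv)
  rw [pairing_coulombKernel_add_const_mul hum hσ s, ← hP, ← hQ] at h1
  have h2 : s * (|Q| + 1) ≤ -P := (le_div_iff₀ hQ0).1 (min_le_right _ _)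
  have h3 : s * Q ≤ s * |Q| := mul_le_mul_of_nonneg_left (le_abs_self Q) hs0.le
  nlinarith

/-- Mass is moved from a central ball, where the potential is at least l + η, to an outer shell,
where it is at most l. Weighting each region by the volume of the other keeps the total mass. -/
theorem not_isMinimizer_of_profile {q : ℕ} {m M a : ℝ} (hM : 0 < M) (ha : 0 < a)
    (hm : m = 4 * π / 3 * M * a ^ 3) {r₀ r₁ l η : ℝ} (hr₀ : 0 < r₀) (hr₀a : r₀ ≤ a) (hr₁ : a < r₁)
    (hη : 0 < η) (hin : ∀ r, 0 < r → r ≤ r₀ → l + η ≤ ballProfile q a r)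
    (hout : ∀ r, a < r → r ≤ r₁ → ballProfile q a r ≤ l) :
    ¬ IsMinimizer 3 (-1) q m M (ballDensity 3 M a) := by
  set B : Set E3 := Metric.closedBall 0 r₀ with hB
  set A : Set E3 := Metric.closedBall 0 r₁ \ Metric.closedBall 0 a with hA
  have hBm : MeasurableSet B := measurableSet_closedBall
  have hAm : MeasurableSet A := measurableSet_closedBall.diff measurableSet_closedBall
  set α := (volume : Measure E3).real B with hα
  set β := (volume : Measure E3).real A with hβ
  have hαpos : 0 < α := by
    rw [hα, hB, measureReal_closedBall_three hr₀.le]; positivity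
  have hβpos : 0 < β := by
    rw [hβ, hA, measureReal_sdiff (Metric.closedBall_subset_closedBall hr₁.le)
      measurableSet_closedBall measure_closedBall_lt_top.ne,
      measureReal_closedBall_three (ha.trans hr₁).le, measureReal_closedBall_three ha.le,
      ← mul_sub]
    have : a ^ 3 < r₁ ^ 3 := pow_lt_pow_left₀ hr₁ ha.le (by norm_num)
    exact mul_pos (by positivity) (by linarith)
  have hAB : HasMoment q (A.indicator fun _ => α) :=
    hasMoment_indicator_const q hAm Set.sdiff_subset α
  have hBB : HasMoment q (B.indicator fun _ => β) :=
    hasMoment_indicator_const q hBm subset_rfl β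
  have hσm := hAB.sub hBB
  set σ : E3 → ℝ := fun x => A.indicator (fun _ => α) x - B.indicator (fun _ => β) x with hσ
  have hmass : ∫ x, σ x = 0 := by
    rw [hσ, integral_sub hAB.integrable hBB.integrable, integral_indicator hAm,
      integral_indicator hBm, setIntegral_const, setIntegral_const, smul_eq_mul, smul_eq_mul]
    ring
  have hmemA : ∀ x, x ∈ A ↔ ‖x‖ ≤ r₁ ∧ a < ‖x‖ := by
    intro x
    simp [hA]
  have hmemB : ∀ x, x ∈ B ↔ ‖x‖ ≤ r₀ := by
    intro x
    simp [hB]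
  refine not_isMinimizer_of_perturbation hM ha hm hσm hmass
    (s₀ := M / (α + β)) (by positivity) (fun s hs hs' x => ?_) ?_
  · have h1 : s * (α + β) ≤ M := (le_div_iff₀ (by positivity)).1 hs'
    have h2 : 0 < s * α := mul_pos hs hαpos
    have h3 : 0 < s * β := mul_pos hs hβpos
    simp only [hσ, Set.indicator, hmemA, hmemB, ballDensity_apply]
    split_ifs <;> constructor <;> linarith
  · obtain ⟨h3, h4⟩ := pairing_ballDensity_right (M := M) ha hσm
    rw [h4]
    have h0 : ∀ᵐ x : E3, x ≠ 0 := by simp [ae_iff]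
    -- Replacing the potential by l everywhere costs nothing since ∫ σ = 0; the excess η on `B`
    -- leaves the strictly negative term -Mηαβ.
    have h5 : ∫ x, M * ballProfile q a ‖x‖ * σ x
        ≤ ∫ x, (M * l * σ x + (-(M * η)) * B.indicator (fun _ => β) x) := by
      refine integral_mono_ae h3
        ((hσm.integrable.const_mul _).add (hBB.integrable.const_mul _)) ?_
      filter_upwards [h0] with x hx
      simp only [hσ]
      by_cases hxB : x ∈ B
      · have hxA : x ∉ A := fun h => by
          have := (hmemA x).1 h
          have := (hmemB x).1 hxB
          linarith
        rw [Set.indicator_of_mem hxB, Set.indicator_of_notMem hxA]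
        have := hin ‖x‖ (norm_pos_iff.2 hx) ((hmemB x).1 hxB)
        have := mul_le_mul_of_nonneg_left this (mul_pos hM hβpos).le
        linarith
      · rw [Set.indicator_of_notMem hxB]
        by_cases hxA : x ∈ A
        · rw [Set.indicator_of_mem hxA]
          have h := (hmemA x).1 hxA
          have := mul_le_mul_of_nonneg_left (hout ‖x‖ h.2 h.1) (mul_pos hM hαpos).le
          linarith
        · rw [Set.indicator_of_notMem hxA]
          simp
    rw [integral_add (hσm.integrable.const_mul _) (hBB.integrable.const_mul _), integral_const_mul,
      integral_const_mul, hmass, integral_indicator hBm, setIntegral_const, smul_eq_mul] at h5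
    have : 0 < M * η * (α * β) := by positivity
    linarith

theorem not_isMinimizer_of_tendsto {q : ℕ} {m M a : ℝ} (hM : 0 < M) (ha : 0 < a)
    (hm : m = 4 * π / 3 * M * a ^ 3) {f g : ℝ → ℝ} (hf : Continuous f) (hg : ContinuousAt g a)
    (hin : ∀ r, 0 < r → r ≤ a → ballProfile q a r = f r)
    (hout : ∀ r, a ≤ r → ballProfile q a r = g r) (hlt : g a < f 0) :
    ¬ IsMinimizer 3 (-1) q m M (ballDensity 3 M a) := by
  have h1 : ∀ᶠ r in nhds (0 : ℝ), (2 * f 0 + g a) / 3 < f r :=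
    hf.continuousAt.eventually_const_lt (by linarith)
  have h2 : ∀ᶠ r in nhds a, g r < (f 0 + 2 * g a) / 3 := hg.eventually_lt_const (by linarith)
  obtain ⟨ε₁, hε₁, h1⟩ := Metric.eventually_nhds_iff.1 h1
  obtain ⟨ε₂, hε₂, h2⟩ := Metric.eventually_nhds_iff.1 h2
  -- The levels l and l + η cut the gap between g a and f 0 into thirds.
  refine not_isMinimizer_of_profile hM ha hm (r₀ := min a (ε₁ / 2)) (r₁ := a + ε₂ / 2)
    (l := (f 0 + 2 * g a) / 3) (η := (f 0 - g a) / 3) (lt_min ha (by linarith)) (min_le_left _ _)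
    (by linarith) (by linarith) (fun r hr hr' => ?_) fun r hr hr' => ?_
  · rw [hin r hr (hr'.trans (min_le_left _ _))]
    have h3 := hr'.trans (min_le_right _ _)
    have := h1 (y := r) (by rw [Real.dist_eq, sub_zero, abs_of_pos hr]; linarith)
    linarith
  · rw [hout r hr.le]
    have := h2 (y := r) (by rw [Real.dist_eq, abs_of_pos (by linarith)]; linarith)
    linarith

end Minimizers

/-! ### Explicit potentials and the thresholds for q = 2, 3, 4 -/

section Profiles

theorem ballProfile_two_inside {a r : ℝ} (hr : 0 < r) (hra : r ≤ a) :
    ballProfile 2 a r = 2 * π / 3 * ((a ^ 3 - 1) * r ^ 2 + 3 / 5 * a ^ 5 + 3 * a ^ 2) := by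
  rw [ballProfile, rieszBall_of_ge _ hra hr, rieszBall_of_ge _ hra hr]
  push_cast
  field_simp
  ring

theorem ballProfile_two_outside {a r : ℝ} (ha : 0 < a) (hra : a ≤ r) :
    ballProfile 2 a r = 2 * π / 3 * (a ^ 3 * r ^ 2 + 3 / 5 * a ^ 5 + 2 * a ^ 3 / r) := by
  have hr := ha.trans_le hra
  rw [ballProfile, rieszBall_of_le _ hra ha, rieszBall_of_le _ hra ha]
  push_cast
  field_simp
  ring

theorem ballProfile_three_inside {a r : ℝ} (hr : 0 < r) (hra : r ≤ a) :
    ballProfile 3 a r = 4 * π / 3 * (-r ^ 6 / 210 + r ^ 4 * a ^ 2 / 10 + r ^ 2 * a ^ 4 / 2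
      + a ^ 6 / 6 + 3 * a ^ 2 / 2 - r ^ 2 / 2) := by
  rw [ballProfile, rieszBall_of_ge _ hra hr, rieszBall_of_ge _ hra hr]
  push_cast
  field_simp
  ring

theorem ballProfile_three_outside {a r : ℝ} (ha : 0 < a) (hra : a ≤ r) :
    ballProfile 3 a r = 4 * π / 3 * (r ^ 3 * a ^ 3 / 3 + 2 * r * a ^ 5 / 5 + a ^ 7 / (35 * r)
      + a ^ 3 / r) := by
  have hr := ha.trans_le hra
  rw [ballProfile, rieszBall_of_le _ hra ha, rieszBall_of_le _ hra ha]
  push_cast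
  field_simp
  ring

theorem ballProfile_four_inside {a r : ℝ} (hr : 0 < r) (hra : r ≤ a) :
    ballProfile 4 a r = 4 * π / 3 * (a ^ 3 * (r ^ 4 / 4 + a ^ 2 * r ^ 2 / 2 + 3 * a ^ 4 / 28)
      + 3 * a ^ 2 / 2 - r ^ 2 / 2) := by
  rw [ballProfile, rieszBall_of_ge _ hra hr, rieszBall_of_ge _ hra hr]
  push_cast
  field_simp
  ring

theorem ballProfile_four_outside {a r : ℝ} (ha : 0 < a) (hra : a ≤ r) :
    ballProfile 4 a r = 4 * π / 3 * (a ^ 3 * (r ^ 4 / 4 + a ^ 2 * r ^ 2 / 2 + 3 * a ^ 4 / 28)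
      + a ^ 3 / r) := by
  have hr := ha.trans_le hra
  rw [ballProfile, rieszBall_of_le _ hra ha, rieszBall_of_le _ hra ha]
  push_cast
  field_simp
  ring

/-- Inside, the profile is affine in r² with slope proportional to a³ - 1. Outside, the increment
factors through ar(r + a) - 2 ≥ 2a³ - 2, so both conditions lead to a ≥ 1. -/
theorem eulerLagrangeBall_two {a : ℝ} (ha : 1 ≤ a) : EulerLagrangeBall 2 a := by
  have ha0 : 0 < a := by linarith
  have h3 : 1 ≤ a ^ 3 := one_le_pow₀ ha
  refine ⟨fun r hr hra => ?_, fun r hra => ?_⟩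
  · rw [ballProfile_two_inside hr hra, ballProfile_two_inside ha0 le_rfl]
    have h1 : r ^ 2 ≤ a ^ 2 := by gcongr
    have h2 : 0 ≤ a ^ 3 - 1 := by linarith
    gcongr
  · have hr : 0 < r := by linarith
    rw [ballProfile_two_outside ha0 le_rfl, ballProfile_two_outside ha0 hra]
    have h : a ^ 3 * r ^ 2 + 2 * a ^ 3 / r - (a ^ 3 * a ^ 2 + 2 * a ^ 3 / a)
        = a ^ 2 / r * (r - a) * (a * r * (r + a) - 2) := by
      field_simp
      ring
    have h1 : 0 ≤ a ^ 2 / r * (r - a) * (a * r * (r + a) - 2) := by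
      refine mul_nonneg (mul_nonneg (by positivity) (by linarith)) ?_
      have : 1 ≤ a * r := by nlinarith
      nlinarith
    refine mul_le_mul_of_nonneg_left ?_ (by positivity)
    linarith

/-- The binding constraint is the centre: at r = 0 the inner factor is 25a⁴/42 - 1/2, and the rest
of it is nonnegative. The outer factor is at least 48a⁴/35 - 1, which is then positive. -/
theorem eulerLagrangeBall_three {a : ℝ} (ha0 : 0 < a) (ha : 21 / 25 ≤ a ^ 4) :
    EulerLagrangeBall 3 a := by
  refine ⟨fun r hr hra => ?_, fun r hra => ?_⟩
  · rw [ballProfile_three_inside hr hra, ballProfile_three_inside ha0 le_rfl]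
    refine mul_le_mul_of_nonneg_left ?_ (by positivity)
    have h1 : r ^ 2 ≤ a ^ 2 := by gcongr
    have hs : 0 < r ^ 2 := by positivity
    have h : (-a ^ 6 / 210 + a ^ 4 * a ^ 2 / 10 + a ^ 2 * a ^ 4 / 2 + a ^ 6 / 6 + 3 * a ^ 2 / 2
        - a ^ 2 / 2) - (-r ^ 6 / 210 + r ^ 4 * a ^ 2 / 10 + r ^ 2 * a ^ 4 / 2 + a ^ 6 / 6
        + 3 * a ^ 2 / 2 - r ^ 2 / 2)
        = (a ^ 2 - r ^ 2) * (25 / 42 * a ^ 4 - 1 / 2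
          + r ^ 2 * (2 / 21 * a ^ 2 - r ^ 2 / 210)) := by
      ring
    have h2 : 0 ≤ (a ^ 2 - r ^ 2) * (25 / 42 * a ^ 4 - 1 / 2
          + r ^ 2 * (2 / 21 * a ^ 2 - r ^ 2 / 210)) := by
      refine mul_nonneg (by linarith) (add_nonneg (by linarith) (mul_nonneg hs.le ?_))
      linarith [sq_nonneg a]
    linarith
  · have hr : 0 < r := by linarith
    rw [ballProfile_three_outside ha0 le_rfl, ballProfile_three_outside ha0 hra]
    refine mul_le_mul_of_nonneg_left ?_ (by positivity)
    have h : (r ^ 3 * a ^ 3 / 3 + 2 * r * a ^ 5 / 5 + a ^ 7 / (35 * r) + a ^ 3 / r)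
        - (a ^ 3 * a ^ 3 / 3 + 2 * a * a ^ 5 / 5 + a ^ 7 / (35 * a) + a ^ 3 / a)
        = a ^ 2 / r * (r - a) * (a * r * (r ^ 2 + r * a + a ^ 2) / 3 + 2 * a ^ 3 * r / 5
          - a ^ 4 / 35 - 1) := by
      field_simp
      ring
    have h1 : 0 ≤ a ^ 2 / r * (r - a) * (a * r * (r ^ 2 + r * a + a ^ 2) / 3 + 2 * a ^ 3 * r / 5
          - a ^ 4 / 35 - 1) := by
      refine mul_nonneg (mul_nonneg (by positivity) (by linarith)) ?_
      have h4 : a * a * (a ^ 2 + a * a + a ^ 2) ≤ a * r * (r ^ 2 + r * a + a ^ 2) := by gcongr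
      have h5 : a ^ 3 * a ≤ a ^ 3 * r := by gcongr
      nlinarith
    linarith

/-- Again the centre decides, through 3a⁵/4 - 1/2 ≥ 0; the outer factor is at least 2a⁵ - 1 > 0. -/
theorem eulerLagrangeBall_four {a : ℝ} (ha0 : 0 < a) (ha : 2 / 3 ≤ a ^ 5) :
    EulerLagrangeBall 4 a := by
  refine ⟨fun r hr hra => ?_, fun r hra => ?_⟩
  · rw [ballProfile_four_inside hr hra, ballProfile_four_inside ha0 le_rfl]
    refine mul_le_mul_of_nonneg_left ?_ (by positivity)
    have h1 : r ^ 2 ≤ a ^ 2 := by gcongr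
    have h : (a ^ 3 * (a ^ 4 / 4 + a ^ 2 * a ^ 2 / 2 + 3 * a ^ 4 / 28) + 3 * a ^ 2 / 2 - a ^ 2 / 2)
        - (a ^ 3 * (r ^ 4 / 4 + a ^ 2 * r ^ 2 / 2 + 3 * a ^ 4 / 28) + 3 * a ^ 2 / 2 - r ^ 2 / 2)
        = (a ^ 2 - r ^ 2) * (3 / 4 * a ^ 5 - 1 / 2 + a ^ 3 * r ^ 2 / 4) := by
      ring
    have h2 : 0 ≤ (a ^ 2 - r ^ 2) * (3 / 4 * a ^ 5 - 1 / 2 + a ^ 3 * r ^ 2 / 4) :=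
      mul_nonneg (by linarith) (add_nonneg (by linarith) (by positivity))
    linarith
  · have hr : 0 < r := by linarith
    rw [ballProfile_four_outside ha0 le_rfl, ballProfile_four_outside ha0 hra]
    refine mul_le_mul_of_nonneg_left ?_ (by positivity)
    have h : (a ^ 3 * (r ^ 4 / 4 + a ^ 2 * r ^ 2 / 2 + 3 * a ^ 4 / 28) + a ^ 3 / r)
        - (a ^ 3 * (a ^ 4 / 4 + a ^ 2 * a ^ 2 / 2 + 3 * a ^ 4 / 28) + a ^ 3 / a)
        = a ^ 2 / r * (r - a) * (a * r * (r + a) * (r ^ 2 + 3 * a ^ 2) / 4 - 1) := by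
      field_simp
      ring
    have h1 : 0 ≤ a ^ 2 / r * (r - a) * (a * r * (r + a) * (r ^ 2 + 3 * a ^ 2) / 4 - 1) := by
      refine mul_nonneg (mul_nonneg (by positivity) (by linarith)) ?_
      have h4 : a * a * (a + a) * (a ^ 2 + 3 * a ^ 2) ≤ a * r * (r + a) * (r ^ 2 + 3 * a ^ 2) := by
        gcongr
      nlinarith
    linarith

/-- Up to the positive prefactor, the central potential exceeds the boundary value by a² - a⁵. For q
= 3 and q = 4 the excess is a²/2 - 25a⁶/42 and a²/2 - 3a⁷/4. -/
theorem not_isMinimizer_two {m M a : ℝ} (hM : 0 < M) (ha : 0 < a)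
    (hm : m = 4 * π / 3 * M * a ^ 3) (h : a < 1) :
    ¬ IsMinimizer 3 (-1) (2 : ℕ) m M (ballDensity 3 M a) := by
  refine not_isMinimizer_of_tendsto hM ha hm
    (f := fun r => 2 * π / 3 * ((a ^ 3 - 1) * r ^ 2 + 3 / 5 * a ^ 5 + 3 * a ^ 2))
    (g := fun r => 2 * π / 3 * (a ^ 3 * r ^ 2 + 3 / 5 * a ^ 5 + 2 * a ^ 3 / r)) (by fun_prop)
    (by fun_prop (disch := exact ha.ne')) (fun r hr hra => ballProfile_two_inside hr hra)
    (fun r hra => ballProfile_two_outside ha hra) ?_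
  refine mul_lt_mul_of_pos_left ?_ (by positivity)
  have h3 : a ^ 3 < 1 := pow_lt_one₀ ha.le h (by norm_num)
  have h4 : a ^ 3 * a ^ 2 < 1 * a ^ 2 := mul_lt_mul_of_pos_right h3 (by positivity)
  have h5 : 2 * a ^ 3 / a = 2 * a ^ 2 := by field_simp
  rw [h5]
  linarith

theorem not_isMinimizer_three {m M a : ℝ} (hM : 0 < M) (ha : 0 < a)
    (hm : m = 4 * π / 3 * M * a ^ 3) (h : a ^ 4 < 21 / 25) :
    ¬ IsMinimizer 3 (-1) (3 : ℕ) m M (ballDensity 3 M a) := by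
  refine not_isMinimizer_of_tendsto hM ha hm
    (f := fun r => 4 * π / 3 * (-r ^ 6 / 210 + r ^ 4 * a ^ 2 / 10 + r ^ 2 * a ^ 4 / 2
      + a ^ 6 / 6 + 3 * a ^ 2 / 2 - r ^ 2 / 2))
    (g := fun r => 4 * π / 3 * (r ^ 3 * a ^ 3 / 3 + 2 * r * a ^ 5 / 5 + a ^ 7 / (35 * r)
      + a ^ 3 / r)) (by fun_prop)
    (by fun_prop (disch := positivity)) (fun r hr hra => ballProfile_three_inside hr hra)
    (fun r hra => ballProfile_three_outside ha hra) ?_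
  refine mul_lt_mul_of_pos_left ?_ (by positivity)
  have h4 : a ^ 4 * a ^ 2 < 21 / 25 * a ^ 2 := mul_lt_mul_of_pos_right h (by positivity)
  have h5 : a ^ 7 / (35 * a) + a ^ 3 / a = a ^ 6 / 35 + a ^ 2 := by field_simp
  linarith

theorem not_isMinimizer_four {m M a : ℝ} (hM : 0 < M) (ha : 0 < a)
    (hm : m = 4 * π / 3 * M * a ^ 3) (h : a ^ 5 < 2 / 3) :
    ¬ IsMinimizer 3 (-1) (4 : ℕ) m M (ballDensity 3 M a) := by
  refine not_isMinimizer_of_tendsto hM ha hm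
    (f := fun r => 4 * π / 3 * (a ^ 3 * (r ^ 4 / 4 + a ^ 2 * r ^ 2 / 2 + 3 * a ^ 4 / 28)
      + 3 * a ^ 2 / 2 - r ^ 2 / 2))
    (g := fun r => 4 * π / 3 * (a ^ 3 * (r ^ 4 / 4 + a ^ 2 * r ^ 2 / 2 + 3 * a ^ 4 / 28)
      + a ^ 3 / r)) (by fun_prop)
    (by fun_prop (disch := positivity)) (fun r hr hra => ballProfile_four_inside hr hra)
    (fun r hra => ballProfile_four_outside ha hra) ?_
  refine mul_lt_mul_of_pos_left ?_ (by positivity)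
  have h4 : a ^ 5 * a ^ 2 < 2 / 3 * a ^ 2 := mul_lt_mul_of_pos_right h (by positivity)
  have h5 : a ^ 3 / a = a ^ 2 := by field_simp
  rw [h5]
  linarith

theorem isConditionallyPositive_two : IsConditionallyPositive 2 :=
  fun _ hf hc => (pairing_norm_sq_eq_zero hf hc).ge

theorem isConditionallyPositive_three : IsConditionallyPositive 3 :=
  fun _ hf hc => pairing_norm_cube_nonneg hf hc

theorem isConditionallyPositive_four : IsConditionallyPositive 4 :=
  fun _ hf hc => pairing_norm_pow_four_nonneg hf hc

/-- The assembled description of the ball density once the Euler–Lagrange inequalities are known to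
hold exactly under the condition `P`. -/
theorem ballDensity_minimizer_iff {q : ℕ} (hq : 1 ≤ q) (hpos : IsConditionallyPositive q)
    {M a m : ℝ} (hM : 0 < M) (ha : 0 < a) (hm : m = 4 * π / 3 * M * a ^ 3) {P : Prop}
    (hP : P → EulerLagrangeBall q a)
    (hN : ¬ P → ¬ IsMinimizer 3 (-1) q m M (ballDensity 3 M a)) :
    (IsMinimizer 3 (-1) q m M (ballDensity 3 M a) ↔ P) ∧
      (IsMinimizer 3 (-1) q m M (ballDensity 3 M a) →
        UniqueUpToTranslation 3 (-1) q m M (ballDensity 3 M a)) := by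
  have h : IsMinimizer 3 (-1) q m M (ballDensity 3 M a) ↔ P :=
    ⟨fun h => by_contra fun h' => hN h' h,
      fun h => ((hP h).isMinimizer_and_unique hq hpos hM ha hm).1⟩
  exact ⟨h, fun h' => ((hP (h.1 h')).isMinimizer_and_unique hq hpos hM ha hm).2⟩

theorem le_pow_iff_rpow_le_mass_div {M a m c : ℝ} {k : ℕ} (hk : k ≠ 0) (hM : 0 < M) (ha : 0 < a)
    (hm : m = 4 * π / 3 * M * a ^ 3) (hc : 0 ≤ c) :
    c ≤ a ^ k ↔ 4 * π / 3 * c ^ (3 / k : ℝ) ≤ m / M := by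
  have h1 : m / M = 4 * π / 3 * a ^ 3 := by rw [hm]; field_simp
  have hk0 : (0 : ℝ) < k := by positivity
  have h2 : a ^ 3 = (a ^ k) ^ (3 / k : ℝ) := by
    rw [← rpow_natCast a k, ← rpow_mul ha.le, mul_div_cancel₀ _ hk0.ne', ← rpow_natCast]
    norm_num
  rw [h1, mul_le_mul_iff_right₀ (by positivity), h2,
    rpow_le_rpow_iff hc (by positivity) (by positivity)]

end Profiles

end

theorem mainTheorem7 (M a m : ℝ) (hM : 0 < M) (ha : 0 < a) (hm : m = 4 * π / 3 * M * a ^ 3) :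
    -- the case `p = -1`, `q = 2`
    (IsAdmissible 3 2 m M (ballDensity 3 M a) ∧
      (IsMinimizer 3 (-1) 2 m M (ballDensity 3 M a) ↔ 1 ≤ a) ∧
      (IsMinimizer 3 (-1) 2 m M (ballDensity 3 M a) ↔ 4 * π / 3 ≤ m / M) ∧
      (IsMinimizer 3 (-1) 2 m M (ballDensity 3 M a) →
        UniqueUpToTranslation 3 (-1) 2 m M (ballDensity 3 M a))) ∧
    -- the case `p = -1`, `q = 3`
    (IsAdmissible 3 3 m M (ballDensity 3 M a) ∧
      (IsMinimizer 3 (-1) 3 m M (ballDensity 3 M a) ↔ 21 / 25 ≤ a ^ 4) ∧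
      (IsMinimizer 3 (-1) 3 m M (ballDensity 3 M a) ↔
        4 * π / 3 * (21 / 25 : ℝ) ^ (3 / 4 : ℝ) ≤ m / M) ∧
      (IsMinimizer 3 (-1) 3 m M (ballDensity 3 M a) →
        UniqueUpToTranslation 3 (-1) 3 m M (ballDensity 3 M a))) ∧
    -- the case `p = -1`, `q = 4`
    (IsAdmissible 3 4 m M (ballDensity 3 M a) ∧
      (IsMinimizer 3 (-1) 4 m M (ballDensity 3 M a) ↔ 2 / 3 ≤ a ^ 5) ∧
      (IsMinimizer 3 (-1) 4 m M (ballDensity 3 M a) ↔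
        4 * π / 3 * (2 / 3 : ℝ) ^ (3 / 5 : ℝ) ≤ m / M) ∧
      (IsMinimizer 3 (-1) 4 m M (ballDensity 3 M a) →
        UniqueUpToTranslation 3 (-1) 4 m M (ballDensity 3 M a))) := by
  obtain ⟨h1, h2⟩ := ballDensity_minimizer_iff one_le_two isConditionallyPositive_two hM ha hm
    (P := 1 ≤ a) eulerLagrangeBall_two fun h => not_isMinimizer_two hM ha hm (not_le.1 h)
  obtain ⟨h3, h4⟩ := ballDensity_minimizer_iff (by norm_num) isConditionallyPositive_three hM ha hm
    (P := 21 / 25 ≤ a ^ 4) (eulerLagrangeBall_three ha)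
    fun h => not_isMinimizer_three hM ha hm (not_le.1 h)
  obtain ⟨h5, h6⟩ := ballDensity_minimizer_iff (by norm_num) isConditionallyPositive_four hM ha hm
    (P := 2 / 3 ≤ a ^ 5) (eulerLagrangeBall_four ha)
    fun h => not_isMinimizer_four hM ha hm (not_le.1 h)
  have h7 := isAdmissible_ballDensity 2 hM ha hm
  have h8 := isAdmissible_ballDensity 3 hM ha hm
  have h9 := isAdmissible_ballDensity 4 hM ha hm
  have e2 : 1 ≤ a ↔ 4 * π / 3 ≤ m / M := by
    simpa using le_pow_iff_rpow_le_mass_div (k := 1) one_ne_zero hM ha hm zero_le_one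
  have e3 := le_pow_iff_rpow_le_mass_div (k := 4) (c := 21 / 25) (by norm_num) hM ha hm
    (by norm_num)
  have e4 := le_pow_iff_rpow_le_mass_div (k := 5) (c := 2 / 3) (by norm_num) hM ha hm (by norm_num)
  simp only [Nat.cast_ofNat] at h1 h2 h3 h4 h5 h6 h7 h8 h9 e3 e4
  exact ⟨⟨h7, h1, h1.trans e2, h2⟩, ⟨h8, h3, h3.trans e3, h4⟩, ⟨h9, h5, h5.trans e4, h6⟩⟩
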